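/- **Conventions.** A *quantum set* $\mathcal X$ is given by a set $\mathrm{At}(\mathcal X)$ of nonzero finite-dimensional complex Hilbert spaces, its *atoms*. Its dual $\mathcal X^*$ has atoms $X^*=L(X,\mathbb C)$, the product $\mathcal X\times\mathcal Y$ has atoms $X\otimes Y$, the unit $\mathbf 1$ has the single atom $\mathbb C$, and $\ell^\infty(\mathcal X)$ is the von Neumann algebra that is the $\ell^\infty$-direct sum of the algebras $L(X)$, $X\in\mathrm{At}(\mathcal X)$. A *binary relation* $R$ from $\mathcal X$ to $\mathcal Y$ is a choice of subspaces $R(X,Y)\le L(X,Y)$ for all atoms $X$, $Y$; these are ordered atomwise by inclusion, with $(S\circ R)(X,Z)=\sum_Y S(Y,Z)\cdot R(X,Y)$, $R^\dagger(Y,X)=\{r^\dagger \mid r\in R(X,Y)\}$, $(R\times S)(X\otimes X',Y\otimes Y')=R(X,Y)\otimes S(X',Y')$, $I_{\mathcal X}(X,X)=\mathbb C 1_X$, and $I_{\mathcal X}(X_1,X_2)=0$ for $X_1\ne X_2$. A *function* from $\mathcal X$ to $\mathcal Y$ is a binary relation $F$ from $\mathcal X$ to $\mathcal Y$ with $F^\dagger\circ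 F\ge I_{\mathcal X}$ and $F\circ F^\dagger\le I_{\mathcal Y}$. A *relation of arity* $(\mathcal X_1,\dots,\mathcal X_n)$ is a binary relation from $\mathcal X_1\times\cdots\times\mathcal X_n$ to $\mathbf 1$, i.e. a choice of subspaces of $L(X_1\otimes\cdots\otimes X_n,\mathbb C)$. These form an orthomodular lattice atomwise, with least element $\bot$, greatest element $\top$ and orthocomplement $\neg$. The conjugate $R_*$ of such a relation has arity $(\mathcal X_1^*,\dots,\mathcal X_n^*)$ and consists of the functionals $\xi_*=\langle \xi\,|\,\cdot\,\rangle$ for $\xi$ in $R$; we identify $\mathcal X^{**}$ with $\mathcal X$. The equality relation $E_{\mathcal Y}$ of arity $(\mathcal Y,\mathcal Y^*)$ is spanned on $Y\otimes Y^*$ by the evaluation functional, and is zero on $Y_1\otimes Y_2^*$ for $Y_1\neq Y_2$. *Primitive formulas* are built from atomic formulas $R(x_1,\dots,x_n)$, with $R$ a relation of arity $(\mathcal X_1,\dots,\mathcal X_n)$ and with distinct variables $x_i$ of sorts $\mathcal X_i$, by $\neg$, $\wedge$ and $(\forall x\in\mathcal X)$. In a context of distinct variables of given sorts a formula is interpreted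 as a relation $[\![\,\cdot\,]\!]$ whose arity is the sequence of these sorts: an atomic formula is interpreted by $R$ with its arguments permuted into place and with a factor $\top$ for every unused variable of the context, $\neg$ and $\wedge$ are interpreted by the orthocomplement and the meet, and $[\![(\forall x\in\mathcal X)\,\phi]\!]$ is the supremum of all relations $S$ with $\top_{\mathcal X}\times S\le[\![\phi]\!]$. Abbreviations: $\phi\vee\psi$ is $\neg(\neg\phi\wedge\neg\psi)$; $(\exists x\in\mathcal X)\,\phi$ is $\neg(\forall x\in\mathcal X)\,\neg\phi$; $\phi\to\psi$ is $\neg\phi\vee(\phi\wedge\psi)$; $(\forall (x=x_*)\in\mathcal X\times\mathcal X^*)\,\phi$ is $(\forall x_*\in\mathcal X^*)(\forall x\in\mathcal X)(E_{\mathcal X}(x,x_*)\to\phi)$; and $(\exists (x=x_*)\in\mathcal X\times\mathcal X^*)\,\phi$ is $\neg(\forall (x=x_*)\in\mathcal X\times\mathcal X^*)\,\neg\phi$. A relation $G$ of arity $(\mathcal X,\mathcal Y^*)$ is a *function graph* if 1. $[\![(\forall x\in\mathcal X)(\exists y_*\in\mathcal Y^*)\,G(x,y_*)]\!]=\top$,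 and 2. $[\![(\forall y_1\in\mathcal Y)(\forall y_{2*}\in\mathcal Y^*)\big((\exists(x=x_*)\in\mathcal X\times\mathcal X^*)(G_*(x_*,y_1)\wedge G(x,y_{2*}))\to E_{\mathcal Y}(y_1,y_{2*})\big)]\!]=\top$. **Theorem.** Let $\mathcal X$ and $\mathcal Y$ be quantum sets. (a) The map $F\mapsto E_{\mathcal Y}\circ(F\times I_{\mathcal Y^*})$ is a bijection from the set of functions from $\mathcal X$ to $\mathcal Y$ onto the set of function graphs of arity $(\mathcal X,\mathcal Y^*)$. (b) There is a bijection $\Phi$ from the set of function graphs of arity $(\mathcal X,\mathcal Y^*)$ onto the set of unital normal $*$-homomorphisms $\ell^\infty(\mathcal Y)\to\ell^\infty(\mathcal X)$ such that, for each function $F$ from $\mathcal X$ to $\mathcal Y$ with graph $G=E_{\mathcal Y}\circ(F\times I_{\mathcal Y^*})$, the homomorphism $\Phi(G)$ is the unique unital normal $*$-homomorphism $\varphi$ that satisfies $b(Y)\cdot f=f\cdot\varphi(b)(X)$ for all $b\in\ell^\infty(\mathcal Y)$, all atoms $X$ and $Y$, and all $f\in F(X,Y)$. It is also the unique unital normal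 $*$-homomorphism $\varphi$ such that $F(X,Y)=\{f\in L(X,Y)\mid b(Y)\cdot f=f\cdot\varphi(b)(X)\text{ for all }b\in\ell^\infty(\mathcal Y)\}$ for all atoms $X$ and $Y$. -/

import Mathlib

open scoped TensorProduct ENNReal ComplexConjugate InnerProductSpace

universe u v u₁ v₁ u₂ v₂ u₃ v₃

noncomputable section

/-! ### Quantum sets -/

set_option linter.checkUnivs false in
/-- A quantum set: a family, indexed by its set of atoms, of nonzero finite-dimensional complex
Hilbert spaces. Distinct indices are distinct atoms. -/
structure QSet : Type (max (u + 1) (v + 1)) where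
  At : Type u
  H : At → Type v
  normed : ∀ a, NormedAddCommGroup (H a)
  hilbert : ∀ a, InnerProductSpace ℂ (H a)
  finDim : ∀ a, FiniteDimensional ℂ (H a)
  nonzero : ∀ a, Nontrivial (H a)

attribute [instance] QSet.normed QSet.hilbert QSet.finDim QSet.nonzero

instance QSet.complete (X : QSet.{u, v}) (a : X.At) : CompleteSpace (X.H a) :=
  FiniteDimensional.complete ℂ (X.H a)

/-- The Hilbert space structure on the dual `E^* = L(E, ℂ)` of a Hilbert space `E`: under the Riesz
correspondence `x ↦ ⟨x, ·⟩`, the inner product of `⟨x, ·⟩` and `⟨y, ·⟩` is `⟨y, x⟩`. The norm is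
the operator norm. -/
abbrev dualHilbert (E : Type v) [NormedAddCommGroup E] [InnerProductSpace ℂ E] [CompleteSpace E] :
    InnerProductSpace ℂ (StrongDual ℂ E) where
  inner ξ η :=
    inner ℂ ((InnerProductSpace.toDual ℂ E).symm η) ((InnerProductSpace.toDual ℂ E).symm ξ)
  norm_sq_eq_re_inner ξ := by
    rw [← LinearIsometryEquiv.norm_map (InnerProductSpace.toDual ℂ E).symm ξ]
    exact norm_sq_eq_re_inner _
  conj_inner_symm ξ η := inner_conj_symm _ _
  add_left ξ η ζ := by rw [map_add, inner_add_right]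
  smul_left ξ η r := by rw [LinearIsometryEquiv.map_smulₛₗ, inner_smul_right]

namespace QSet

/-- The dual quantum set `X^*`, whose atoms are the duals of the atoms of `X`. -/
def dual (X : QSet.{u, v}) : QSet.{u, v} where
  At := X.At
  H a := StrongDual ℂ (X.H a)
  normed _ := inferInstance
  hilbert a := dualHilbert (X.H a)
  finDim _ := inferInstance
  nonzero _ := inferInstance

/-- The atom `X_a^*` of `X^*` that is dual to the atom `X_a` of `X`. -/
def dualAtom (X : QSet.{u, v}) (a : X.At) : X.dual.At := a

/-- The Cartesian product of two quantum sets. -/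
def prod (X : QSet.{u, v}) (Y : QSet.{u₁, v₁}) : QSet.{max u u₁, max v v₁} where
  At := X.At × Y.At
  H p := X.H p.1 ⊗[ℂ] Y.H p.2
  normed _ := inferInstance
  hilbert _ := inferInstance
  finDim _ := inferInstance
  nonzero _ := inferInstance

/-- The atom `X_a ⊗ Y_b` of `X × Y`. -/
def prodAtom (X : QSet.{u, v}) (Y : QSet.{u₁, v₁}) (a : X.At) (b : Y.At) : (X.prod Y).At := (a, b)

/-- The monoidal unit `𝟏`, whose only atom is `ℂ`. -/
def one : QSet.{0, 0} where
  At := Unit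
  H _ := ℂ
  normed _ := inferInstance
  hilbert _ := inferInstance
  finDim _ := inferInstance
  nonzero _ := inferInstance

/-- The only atom of `𝟏`. -/
def oneAtom : one.At := ()

end QSet

/-! ### Binary relations between quantum sets -/

/-- A binary relation `R` from `X` to `Y`: a subspace `R(X, Y) ≤ L(X, Y)` for each pair of atoms.
The atoms are finite-dimensional, so every linear map between them is bounded. Binary relations are
ordered atomwise by inclusion. -/
abbrev BinRel (X : QSet.{u, v}) (Y : QSet.{u₁, v₁}) :=
  ∀ (a : X.At) (b : Y.At), Submodule ℂ (X.H a →ₗ[ℂ] Y.H b)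

namespace BinRel

/-- The identity relation `I_X`: scalar multiples of the identity on each atom, and zero between
distinct atoms. -/
def id (X : QSet.{u, v}) : BinRel X X := fun a b =>
  Submodule.span ℂ {f | ∃ h : a = b, ∀ x, f x = cast (congrArg X.H h) x}

/-- The composition `S ∘ R`: the sum over the atoms `Y` of the spaces `S(Y, Z) · R(X, Y)`. -/
def comp {X : QSet.{u, v}} {Y : QSet.{u₁, v₁}} {Z : QSet.{u₂, v₂}}
    (S : BinRel Y Z) (R : BinRel X Y) : BinRel X Z := fun a c =>
  Submodule.span ℂ {f | ∃ (b : Y.At) (s : Y.H b →ₗ[ℂ] Z.H c) (r : X.H a →ₗ[ℂ] Y.H b),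
    s ∈ S b c ∧ r ∈ R a b ∧ f = s ∘ₗ r}

/-- The adjoint relation `R†(Y, X) = {r† | r ∈ R(X, Y)}`. -/
def dagger {X : QSet.{u, v}} {Y : QSet.{u₁, v₁}} (R : BinRel X Y) : BinRel Y X := fun b a =>
  (R a b).map (LinearMap.adjoint (𝕜 := ℂ) (E := X.H a) (F := Y.H b)).toLinearMap

/-- The product relation `R × S`, spanned atomwise by the tensor products `r ⊗ s`. -/
def prod {X : QSet.{u, v}} {Y : QSet.{u₁, v₁}} {X' : QSet.{u₂, v₂}} {Y' : QSet.{u₃, v₃}}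
    (R : BinRel X Y) (S : BinRel X' Y') : BinRel (X.prod X') (Y.prod Y') := fun p q =>
  Submodule.span ℂ {f | ∃ r ∈ R p.1 q.1, ∃ s ∈ S p.2 q.2, f = TensorProduct.map r s}

/-- The space spanned by the evaluation functional `Y_a ⊗ Y_a^* → ℂ` if `a = b`, and the zero
subspace of `L(Y_a ⊗ Y_b^*, ℂ)` if `a ≠ b`. -/
def evalSpace (Y : QSet.{u, v}) (a b : Y.At) :
    Submodule ℂ (Y.H a ⊗[ℂ] StrongDual ℂ (Y.H b) →ₗ[ℂ] ℂ) :=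
  Submodule.span ℂ {ε | ∃ h : a = b, ∀ (y : Y.H a) (η : StrongDual ℂ (Y.H b)),
    ε (y ⊗ₜ[ℂ] η) = η (cast (congrArg Y.H h) y)}

/-- The equality relation `E_Y`, as a binary relation from `Y × Y^*` to `𝟏`. -/
def equality (Y : QSet.{u, v}) : BinRel (Y.prod Y.dual) QSet.one := fun p _ =>
  evalSpace Y p.1 p.2

/-- A function from `X` to `Y`: a binary relation `F` with `F† ∘ F ≥ I_X` and `F ∘ F† ≤ I_Y`. -/
def IsFunction {X : QSet.{u, v}} {Y : QSet.{u₁, v₁}} (F : BinRel X Y) : Prop :=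
  BinRel.id X ≤ F.dagger.comp F ∧ F.comp F.dagger ≤ BinRel.id Y

end BinRel

/-! ### Relations of finite arity -/

/-- The space `L(X₁ ⊗ ⋯ ⊗ Xₙ, ℂ)` of functionals on a tensor product of atoms, presented as the
space of multilinear functionals on `X₁ × ⋯ × Xₙ`. -/
abbrev Functional {ι : Type*} (Γ : ι → QSet.{u, v}) (a : ∀ i, (Γ i).At) :=
  MultilinearMap ℂ (fun i => (Γ i).H (a i)) ℂ

/-- A relation of arity `Γ = (X₁, …, Xₙ)`: a predicate on the product `X₁ × ⋯ × Xₙ`, that is, a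
subspace of `L(X₁ ⊗ ⋯ ⊗ Xₙ, ℂ)` for each choice of atoms. Order, meets, joins, `⊤` and `⊥` are
atomwise. -/
abbrev QRel {ι : Type*} (Γ : ι → QSet.{u, v}) :=
  ∀ a : (∀ i, (Γ i).At), Submodule ℂ (Functional Γ a)

/-- The inner product on `L(X₁ ⊗ ⋯ ⊗ Xₙ, ℂ)`, as the dual of the Hilbert space tensor product,
computed on the orthonormal basis of product vectors. -/
def functionalInner {ι : Type*} [Fintype ι] {Γ : ι → QSet.{u, v}} {a : ∀ i, (Γ i).At}
    (ξ η : Functional Γ a) : ℂ :=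
  letI : DecidableEq ι := Classical.decEq ι
  ∑ j : (∀ i, Fin (Module.finrank ℂ ((Γ i).H (a i)))),
    conj (ξ fun i => stdOrthonormalBasis ℂ ((Γ i).H (a i)) (j i)) *
      η fun i => stdOrthonormalBasis ℂ ((Γ i).H (a i)) (j i)

/-- `ρ ⊗ τ`, as a functional on the tensor product of all the factors. -/
def Functional.tmul {ι κ : Type*} {Γ : ι ⊕ κ → QSet.{u, v}} {a : ∀ i, (Γ i).At}
    (ρ : Functional (fun i => Γ (.inl i)) fun i => a (.inl i))
    (τ : Functional (fun k => Γ (.inr k)) fun k => a (.inr k)) : Functional Γ a :=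
  MultilinearMap.uncurrySum ((LinearMap.toSpanSingleton ℂ _ τ).compMultilinearMap ρ)

namespace QRel

/-- The orthocomplement `¬ R`. -/
def neg {ι : Type*} [Fintype ι] {Γ : ι → QSet.{u, v}} (R : QRel Γ) : QRel Γ := fun a =>
  { carrier := {η | ∀ ξ ∈ R a, functionalInner ξ η = 0}
    zero_mem' := fun ξ _ => by simp [functionalInner]
    add_mem' := fun {η ζ} hη hζ ξ hξ => by
      have h1 := hη ξ hξ
      have h2 := hζ ξ hξ
      simp only [functionalInner] at h1 h2 ⊢
      simp only [add_apply, mul_add, Finset.sum_add_distrib, h1, h2, add_zero]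
    smul_mem' := fun c η hη ξ hξ => by
      have h1 := hη ξ hξ
      simp only [functionalInner] at h1 ⊢
      simp only [smul_apply, smul_eq_mul, mul_left_comm _ c, ← Finset.mul_sum, h1,
        mul_zero] }

/-- The Cartesian product `P × Q` of two relations, of arity the concatenation of their arities. -/
def prod {ι κ : Type*} {Γ : ι ⊕ κ → QSet.{u, v}}
    (P : QRel fun i => Γ (.inl i)) (Q : QRel fun k => Γ (.inr k)) : QRel Γ := fun a =>
  Submodule.span ℂ {ξ | ∃ ρ ∈ P fun i => a (.inl i), ∃ τ ∈ Q fun k => a (.inr k),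
    ξ = Functional.tmul ρ τ}

/-- The permuted relation `π_#(R)`, for a relation `R` of arity `(X_{π(1)}, …, X_{π(n)})`:
its elements are the functionals `(v_i)_i ↦ ρ ((v_{π(k)})_k)`. -/
def perm {ι κ : Type*} {Γ : ι → QSet.{u, v}} (π : κ ≃ ι) (R : QRel fun k => Γ (π k)) : QRel Γ :=
  fun a => (R fun k => a (π k)).map
    (MultilinearMap.domDomCongrLinearEquiv' ℂ ℂ (fun i => (Γ i).H (a i)) ℂ
      π.symm).symm.toLinearMap

/-- The bijection that lists first the variables `x`, and then all of the remaining ones. -/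
def completion {ι κ : Type*} (x : κ ↪ ι) : κ ⊕ {i : ι // i ∉ Set.range x} ≃ ι :=
  Equiv.ofBijective (Sum.elim x Subtype.val) (by
    refine ⟨x.injective.sumElim Subtype.val_injective fun k i h => i.2 ⟨k, h⟩, fun i => ?_⟩
    by_cases hi : i ∈ Set.range x
    · obtain ⟨k, hk⟩ := hi
      exact ⟨.inl k, hk⟩
    · exact ⟨.inr ⟨i, hi⟩, rfl⟩)

/-- The interpretation, in the context `Γ`, of the atomic formula `R(x₁, …, x_m)` for distinct
variables `x₁, …, x_m` of the context: the relation `π_#(R × ⊤ × ⋯ × ⊤)`, with `π` a bijection that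
lists the variables `x₁, …, x_m` first. -/
def inContext {ι κ : Type*} {Γ : ι → QSet.{u, v}} (x : κ ↪ ι) (R : QRel fun k => Γ (x k)) :
    QRel Γ :=
  perm (completion x) (prod (Γ := fun s => Γ (completion x s)) R ⊤)

/-- The relation `⊤_X × R` of arity `(X, X₁, …, Xₙ)`. -/
def topProd {n : ℕ} {Γ : Fin n → QSet.{u, v}} (X : QSet.{u, v}) (R : QRel Γ) :
    QRel (Fin.cons X Γ : Fin (n + 1) → QSet.{u, v}) :=
  inContext (Γ := (Fin.cons X Γ : Fin (n + 1) → QSet.{u, v})) (Fin.succEmb n) R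

/-- Transport of a relation along an equality of arities. -/
def recast {ι : Type*} {Γ Δ : ι → QSet.{u, v}} (h : ∀ i, Γ i = Δ i) (R : QRel Δ) : QRel Γ :=
  (funext h : Γ = Δ) ▸ R

end QRel

/-! ### Relations of arity two -/

/-- The functional `(x, z) ↦ ξ (x ⊗ z)`, linearly in `ξ`. This is the identification of functionals
on the tensor product of two atoms with bilinear functionals. -/
def bilinearize (Γ : Fin 2 → QSet.{u, v}) (a : ∀ i, (Γ i).At) :
    ((Γ 0).H (a 0) ⊗[ℂ] (Γ 1).H (a 1) →ₗ[ℂ] ℂ) →ₗ[ℂ] Functional Γ a where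
  toFun ξ := MultilinearMap.mk' (fun w => ξ (w 0 ⊗ₜ[ℂ] w 1))
    (fun w i x y => by
      fin_cases i
      · simp [TensorProduct.add_tmul]
      · simp [TensorProduct.tmul_add])
    (fun w i c x => by
      fin_cases i
      · simp [← TensorProduct.smul_tmul']
      · simp [TensorProduct.tmul_smul])
  map_add' ξ η := rfl
  map_smul' c ξ := rfl

/-- A binary relation from `X × Z` to `𝟏`, regarded as a relation of arity `(X, Z)`. -/
def QRel.ofBin {X Z : QSet.{u, v}} (R : BinRel (X.prod Z) QSet.one) : QRel ![X, Z] := fun a =>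
  (R (X.prodAtom Z (a 0) (a 1)) QSet.oneAtom).map (bilinearize ![X, Z] a)

/-- The equality relation `E_Y`, of arity `(Y, Y^*)`. -/
def QRel.equality (Y : QSet.{u, v}) : QRel ![Y, Y.dual] := QRel.ofBin (BinRel.equality Y)

/-- The relation `E_Y ∘ (F × I_{Y^*})` of arity `(X, Y^*)` obtained from a binary relation `F` from
`X` to `Y`. -/
def BinRel.bend {X Y : QSet.{u, v}} (F : BinRel X Y) : QRel ![X, Y.dual] :=
  QRel.ofBin ((BinRel.equality Y).comp (F.prod (BinRel.id Y.dual)))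

/-- The conjugate `ξ_*` of a functional `ξ` on `E₁ ⊗ ⋯ ⊗ Eₙ`: the functional on
`E₁^* ⊗ ⋯ ⊗ Eₙ^* = (E₁ ⊗ ⋯ ⊗ Eₙ)^*` with `ξ_*(η) = ⟨ξ, η⟩`. On `η = ⟨h₁, ·⟩ ⊗ ⋯ ⊗ ⟨hₙ, ·⟩` it takes
the value `conj (ξ (h₁ ⊗ ⋯ ⊗ hₙ))`. -/
def conjFunctional {ι : Type*} {E : ι → Type v} [∀ i, NormedAddCommGroup (E i)]
    [∀ i, InnerProductSpace ℂ (E i)] [∀ i, CompleteSpace (E i)] (ξ : MultilinearMap ℂ E ℂ) :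
    MultilinearMap ℂ (fun i => StrongDual ℂ (E i)) ℂ where
  toFun η := conj (ξ fun i => (InnerProductSpace.toDual ℂ (E i)).symm (η i))
  map_update_add' η i x y := by
    have key : ∀ z : StrongDual ℂ (E i),
        (fun j => (InnerProductSpace.toDual ℂ (E j)).symm (Function.update η i z j)) =
          Function.update (fun j => (InnerProductSpace.toDual ℂ (E j)).symm (η j)) i
            ((InnerProductSpace.toDual ℂ (E i)).symm z) := fun z => by
      funext j
      exact Function.apply_update (fun j => (InnerProductSpace.toDual ℂ (E j)).symm) η i z j
    simp only [key, map_add, MultilinearMap.map_update_add]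
  map_update_smul' η i c x := by
    have key : ∀ z : StrongDual ℂ (E i),
        (fun j => (InnerProductSpace.toDual ℂ (E j)).symm (Function.update η i z j)) =
          Function.update (fun j => (InnerProductSpace.toDual ℂ (E j)).symm (η j)) i
            ((InnerProductSpace.toDual ℂ (E i)).symm z) := fun z => by
      funext j
      exact Function.apply_update (fun j => (InnerProductSpace.toDual ℂ (E j)).symm) η i z j
    simp only [key, LinearIsometryEquiv.map_smulₛₗ, MultilinearMap.map_update_smul, smul_eq_mul,
      map_mul, Complex.conj_conj]

/-- The space `{ξ_* | ξ ∈ P}`. -/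
def conjSubspace {ι : Type*} {E : ι → Type v} [∀ i, NormedAddCommGroup (E i)]
    [∀ i, InnerProductSpace ℂ (E i)] [∀ i, CompleteSpace (E i)]
    (P : Submodule ℂ (MultilinearMap ℂ E ℂ)) :
    Submodule ℂ (MultilinearMap ℂ (fun i => StrongDual ℂ (E i)) ℂ) where
  carrier := {ζ | ∃ ξ ∈ P, ζ = conjFunctional ξ}
  zero_mem' := ⟨0, P.zero_mem, by ext; simp [conjFunctional]⟩
  add_mem' := by
    rintro _ _ ⟨ξ, hξ, rfl⟩ ⟨η, hη, rfl⟩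
    exact ⟨ξ + η, P.add_mem hξ hη, by ext; simp [conjFunctional]⟩
  smul_mem' := by
    rintro c _ ⟨ξ, hξ, rfl⟩
    exact ⟨conj c • ξ, P.smul_mem _ hξ, by ext; simp [conjFunctional]⟩

/-- The conjugate relation `R_*`, of arity `(X₁^*, …, Xₙ^*)`. -/
def QRel.conj {ι : Type*} {Γ : ι → QSet.{u, v}} (R : QRel Γ) : QRel fun i => (Γ i).dual :=
  fun a : (∀ i, (Γ i).At) => conjSubspace (R a)

/-- The canonical identification `y ↦ (η ↦ η y)` of each atom of `Y` with the corresponding atom of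
`Y^{**}`. -/
def QSet.toBidual (Y : QSet.{u, v}) (b : Y.At) :
    Y.H b →ₗ[ℂ] Y.dual.dual.H (Y.dual.dualAtom (Y.dualAtom b)) :=
  (NormedSpace.inclusionInDoubleDual ℂ (Y.H b)).toLinearMap

/-- The conjugate `G_*` of a relation `G` of arity `(X, Y^*)`, regarded as a relation of arity
`(X^*, Y)` by means of the canonical identification of `Y` with `Y^{**}`. -/
def QRel.conjDual {X Y : QSet.{u, v}} (G : QRel ![X, Y.dual]) : QRel ![X.dual, Y] := fun a =>
  let a' : ∀ i, ((![X, Y.dual] : Fin 2 → QSet.{u, v}) i).dual.At :=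
    Fin.cons (a 0) (Fin.cons (Y.dual.dualAtom (Y.dualAtom (a 1))) finZeroElim)
  let u : ∀ i, ((![X.dual, Y] : Fin 2 → QSet.{u, v}) i).H (a i) →ₗ[ℂ]
      ((![X, Y.dual] : Fin 2 → QSet.{u, v}) i).dual.H (a' i) :=
    Fin.cons (LinearMap.id (R := ℂ) (M := ((![X.dual, Y] : Fin 2 → QSet.{u, v}) 0).H (a 0)))
      (Fin.cons (Y.toBidual (a 1)) finZeroElim)
  (G.conj a').map (MultilinearMap.compLinearMapₗ u)

/-! ### Primitive formulas and their interpretation -/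

set_option linter.checkUnivs false in
/-- Primitive formulas in a context `Γ`, that is, a finite sequence of distinct variables of sorts
`Γ 0, Γ 1, …`. Variables are referred to by their position in the context, and a quantifier binds
the first variable of the extended context. The variables of an atomic formula are distinct. -/
inductive Formula : {n : ℕ} → (Fin n → QSet.{u, v}) → Type (max (u + 1) (v + 1))
  | atom {n m : ℕ} {Γ : Fin n → QSet.{u, v}} {Δ : Fin m → QSet.{u, v}} (R : QRel Δ)
      (x : Fin m ↪ Fin n) (sort : ∀ i, Γ (x i) = Δ i) : Formula Γ
  | neg {n : ℕ} {Γ : Fin n → QSet.{u, v}} (φ : Formula Γ) : Formula Γ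
  | and {n : ℕ} {Γ : Fin n → QSet.{u, v}} (φ ψ : Formula Γ) : Formula Γ
  | all {n : ℕ} {Γ : Fin n → QSet.{u, v}} (X : QSet.{u, v})
      (φ : Formula (Fin.cons X Γ : Fin (n + 1) → QSet.{u, v})) : Formula Γ

namespace Formula

/-- The interpretation of a primitive formula in its context. -/
def interp : {n : ℕ} → {Γ : Fin n → QSet.{u, v}} → Formula Γ → QRel Γ
  | _, _, atom R x sort => QRel.inContext x (QRel.recast sort R)
  | _, _, neg φ => φ.interp.neg
  | _, _, and φ ψ => φ.interp ⊓ ψ.interp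
  | _, _, all X φ => sSup {R | QRel.topProd X R ≤ φ.interp}

variable {n : ℕ} {Γ : Fin n → QSet.{u, v}}

/-- `φ ∨ ψ` abbreviates `¬(¬φ ∧ ¬ψ)`. -/
def or (φ ψ : Formula Γ) : Formula Γ := neg (and (neg φ) (neg ψ))

/-- `(∃ x ∈ X) φ` abbreviates `¬(∀ x ∈ X) ¬φ`. -/
def ex (X : QSet.{u, v}) (φ : Formula (Fin.cons X Γ : Fin (n + 1) → QSet.{u, v})) : Formula Γ :=
  neg (all X (neg φ))

/-- The Sasaki arrow: `φ → ψ` abbreviates `¬φ ∨ (φ ∧ ψ)`. -/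
def imp (φ ψ : Formula Γ) : Formula Γ := or (neg φ) (and φ ψ)

/-- The atomic formula `R(x_i, x_j)`, for a relation `R` of arity `(A, B)`. -/
def atom₂ {A B : QSet.{u, v}} (R : QRel ![A, B]) (i j : Fin n) (hij : i ≠ j) (hi : Γ i = A)
    (hj : Γ j = B) : Formula Γ :=
  atom R ⟨![i, j], by
    intro k l h
    fin_cases k <;> fin_cases l <;> simp_all [eq_comm]⟩ (Fin.forall_fin_two.mpr ⟨hi, hj⟩)

/-- `(∀ (x = x_*) ∈ X × X^*) φ` abbreviates `(∀ x_* ∈ X^*) (∀ x ∈ X) (E_X(x, x_*) → φ)`. The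
variables `x` and `x_*` have positions `0` and `1` in the context of `φ`. -/
def allDiag (X : QSet.{u, v})
    (φ : Formula (Fin.cons X (Fin.cons X.dual Γ : Fin (n + 1) → QSet.{u, v}) :
      Fin (n + 1 + 1) → QSet.{u, v})) : Formula Γ :=
  all X.dual (all X (imp (atom₂ (QRel.equality X) 0 1 Fin.zero_ne_one rfl rfl) φ))

/-- `(∃ (x = x_*) ∈ X × X^*) φ` abbreviates `¬(∀ (x = x_*) ∈ X × X^*) ¬φ`. -/
def exDiag (X : QSet.{u, v})
    (φ : Formula (Fin.cons X (Fin.cons X.dual Γ : Fin (n + 1) → QSet.{u, v}) :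
      Fin (n + 1 + 1) → QSet.{u, v})) : Formula Γ :=
  neg (allDiag X (neg φ))

end Formula

/-! ### Function graphs -/

/-- The sentence `(∀ x ∈ X) (∃ y_* ∈ Y^*) G(x, y_*)`.
The context of the atomic formula is `(y_*, x)`. -/
def totalSentence {X Y : QSet.{u, v}} (G : QRel ![X, Y.dual]) :
    Formula (Fin.elim0 : Fin 0 → QSet.{u, v}) :=
  .all X (.ex Y.dual (.atom₂ G 1 0 (by decide) rfl rfl))

/-- The sentence
`(∀ y₁ ∈ Y) (∀ y₂_* ∈ Y^*) ((∃ (x = x_*) ∈ X × X^*) (G_*(x_*, y₁) ∧ G(x, y₂_*)) → E_Y(y₁, y₂_*))`.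
The context of the implication is `(y₂_*, y₁)`, and that of the conjunction is
`(x, x_*, y₂_*, y₁)`. -/
def univalentSentence {X Y : QSet.{u, v}} (G : QRel ![X, Y.dual]) :
    Formula (Fin.elim0 : Fin 0 → QSet.{u, v}) :=
  .all Y (.all Y.dual (.imp
    (.exDiag X (.and (.atom₂ G.conjDual 1 3 (by decide) rfl rfl)
      (.atom₂ G 0 2 (by decide) rfl rfl)))
    (.atom₂ (QRel.equality Y) 1 0 (by decide) rfl rfl)))

/-- A function graph of arity `(X, Y^*)`: both sentences are true. -/
def IsFunctionGraph {X Y : QSet.{u, v}} (G : QRel ![X, Y.dual]) : Prop :=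
  (totalSentence G).interp = ⊤ ∧ (univalentSentence G).interp = ⊤

/-! ### The von Neumann algebra of a quantum set -/

/-- The von Neumann algebra `ℓ^∞(X)`: the `ℓ^∞`-direct sum of the algebras `L(X_a)`. -/
abbrev LInf (X : QSet.{u, v}) := lp (fun a : X.At => X.H a →L[ℂ] X.H a) ∞

/-- The operator order on `ℓ^∞(X)`: `a ≤ b` if and only if each component of `b - a` is a positive
operator. -/
instance LInf.partialOrder (X : QSet.{u, v}) : PartialOrder (LInf X) :=
  PartialOrder.lift (fun (c : LInf X) (a : X.At) => c a) fun _ _ h => Subtype.ext h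

/-- A `*`-homomorphism is normal if it preserves the least upper bounds of (bounded) upward directed
sets of self-adjoint elements. -/
def IsNormalHom {X Y : QSet.{u, v}} (φ : LInf Y →⋆ₐ[ℂ] LInf X) : Prop :=
  ∀ (S : Set (LInf Y)) (s : LInf Y), S.Nonempty → DirectedOn (· ≤ ·) S →
    (∀ c ∈ S, IsSelfAdjoint c) → IsLUB S s → IsLUB (φ '' S) (φ s)

/-- `φ = F^⋆`: the homomorphism `φ` satisfies `b · f = f · φ(b)` for all `b ∈ ℓ^∞(Y)` and all
`f ∈ F(X, Y)`. -/
def IsDualHom {X Y : QSet.{u, v}} (F : BinRel X Y) (φ : LInf Y →⋆ₐ[ℂ] LInf X) : Prop :=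
  ∀ (a : X.At) (b : Y.At), ∀ f ∈ F a b, ∀ (c : LInf Y) (x : X.H a),
    (c b) (f x) = f ((φ c) a x)

/-- The binary relation of all intertwiners of a `*`-homomorphism `φ`:
the atomwise spaces `{f ∈ L(X, Y) | b · f = f · φ(b) for all b ∈ ℓ^∞(Y)}`. -/
def intertwiners {X Y : QSet.{u, v}} (φ : LInf Y →⋆ₐ[ℂ] LInf X) : BinRel X Y := fun a b =>
  { carrier := {f | ∀ (c : LInf Y) (x : X.H a), (c b) (f x) = f ((φ c) a x)}
    zero_mem' := fun c x => by simp
    add_mem' := fun {f g} hf hg c x => by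
      simp only [LinearMap.add_apply, map_add, hf c x, hg c x]
    smul_mem' := fun r f hf c x => by
      simp only [LinearMap.smul_apply, map_smul, hf c x] }

end

/-! ### The Hilbert space of functionals -/

section FunctionalInner

variable {ι : Type*} [Fintype ι] {Γ : ι → QSet.{u, v}} {a : ∀ i, (Γ i).At}

/-! Relations of arity `(X, Y^*)` are binary relations in disguise: an operator `f : X_a → Y_b` is
the same as the bilinear form `(x, η) ↦ η (f x)`, so bending is a bijection on all relations
(`BinRel.bend_injective`, `BinRel.exists_bend_eq`). Under this dictionary the two sentences become
statements about operators (`isFunctionGraph_bend_iff`). The first says that no nonzero vector is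
killed by all of `F`. The second says that `f' f†` lies in `I_Y` for all `f`, `f'` in `F` that start
at the same atom. The second translation rests on `Formula.mem_interp_allDiag`: quantifying over `x
= x_*` amounts to tensoring with the evaluation functional. The adjoint of this operation is
contraction, and contracting `f†` with `f'` gives `f' f†`.

The second condition is literally `F F† ≤ I`. For `F† F ≥ I`, the heart of part (a) is that totality
and univalence together yield a finite resolution `1 = ∑ f_k† f_k` on each atom
(`BinRel.exists_squareSum_eq_id`), built up greedily from coisometries in `F`.

The resolution also drives part (b). It defines the homomorphism by `φ(c) = ∑ f_k† c f_k`, bounds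
its norm, and writes `⟨φ(c) x, x⟩` as a finite sum of vector functionals, from which normality
follows. Since `g = ∑ (g f_k†) f_k` with each `g f_k†` scalar or zero, it also shows that `F`
contains every intertwiner of `φ`. Conversely, the intertwiners of a normal `φ` form a function.
Univalence holds because `f' f†` commutes with all of `ℓ^∞(Y)`. Totality holds because a vector
killed by all intertwiners is killed by `φ` of every finite atomic projection, and by normality the
supremum of these images is `1`. -/

theorem functionalInner_eq_sum [DecidableEq ι] (ξ η : Functional Γ a) :
    functionalInner ξ η = ∑ j : (∀ i, Fin (Module.finrank ℂ ((Γ i).H (a i)))),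
      conj (ξ fun i => stdOrthonormalBasis ℂ ((Γ i).H (a i)) (j i)) *
        η fun i => stdOrthonormalBasis ℂ ((Γ i).H (a i)) (j i) := by
  unfold functionalInner
  congr!

theorem functionalInner_conj_symm (ξ η : Functional Γ a) :
    conj (functionalInner η ξ) = functionalInner ξ η := by
  simp [functionalInner, map_sum, mul_comm]

theorem functionalInner_add_left (ξ η ζ : Functional Γ a) :
    functionalInner (ξ + η) ζ = functionalInner ξ ζ + functionalInner η ζ := by
  simp [functionalInner, add_mul, Finset.sum_add_distrib]

theorem functionalInner_smul_left (ξ ζ : Functional Γ a) (r : ℂ) :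
    functionalInner (r • ξ) ζ = conj r * functionalInner ξ ζ := by
  simp [functionalInner, Finset.mul_sum, mul_assoc]

theorem functionalInner_self (ξ : Functional Γ a) :
    letI : DecidableEq ι := Classical.decEq ι
    functionalInner ξ ξ = ((∑ j : (∀ i, Fin (Module.finrank ℂ ((Γ i).H (a i)))),
      ‖ξ fun i => stdOrthonormalBasis ℂ ((Γ i).H (a i)) (j i)‖ ^ 2 : ℝ) : ℂ) := by
  simp only [functionalInner, Complex.conj_mul', Complex.ofReal_sum, Complex.ofReal_pow]

theorem eq_zero_of_functionalInner_self (ξ : Functional Γ a) (h : functionalInner ξ ξ = 0) :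
    ξ = 0 := by
  classical
  rw [functionalInner_self, Complex.ofReal_eq_zero,
    Finset.sum_eq_zero_iff_of_nonneg fun _ _ => by positivity] at h
  refine Module.Basis.ext_multilinear
    (fun i => (stdOrthonormalBasis ℂ ((Γ i).H (a i))).toBasis) fun j => ?_
  have := h j (Finset.mem_univ _)
  simpa using this

/-- The inner product of functionals makes them an inner product space. -/
@[reducible]
noncomputable def functionalCore (Γ : ι → QSet.{u, v}) (a : ∀ i, (Γ i).At) :
    InnerProductSpace.Core ℂ (Functional Γ a) where
  inner := functionalInner
  conj_inner_symm := functionalInner_conj_symm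
  re_inner_nonneg ξ := by
    classical
    rw [functionalInner_self]
    simp only [RCLike.re_to_complex, Complex.ofReal_re]
    positivity
  add_left := functionalInner_add_left
  smul_left := functionalInner_smul_left
  definite := eq_zero_of_functionalInner_self

/-- The norm on functionals that comes from their inner product. -/
@[reducible]
noncomputable def functionalNormed (Γ : ι → QSet.{u, v}) (a : ∀ i, (Γ i).At) :
    NormedAddCommGroup (Functional Γ a) :=
  (functionalCore Γ a).toNormedAddCommGroup

/-- The inner product space of functionals. -/
@[reducible]
noncomputable def functionalInnerProductSpace (Γ : ι → QSet.{u, v}) (a : ∀ i, (Γ i).At) :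
    @InnerProductSpace ℂ (Functional Γ a) _ (functionalNormed Γ a).toSeminormedAddCommGroup :=
  InnerProductSpace.ofCore (functionalCore Γ a).toCore

attribute [local instance] functionalNormed functionalInnerProductSpace

/-- The inner product space structure was built from `functionalInner` itself, so both sides agree
by definition. The general theory of orthogonal complements in finite dimension becomes available
for negation. -/
theorem QRel.neg_apply (R : QRel Γ) : R.neg a = (R a)ᗮ := by
  ext η
  exact Iff.rfl

theorem QRel.neg_neg (R : QRel Γ) : R.neg.neg = R := by
  funext a
  rw [QRel.neg_apply, QRel.neg_apply, Submodule.orthogonal_orthogonal]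

theorem QRel.neg_le_neg {R S : QRel Γ} (h : R ≤ S) : S.neg ≤ R.neg := fun a _ hη ξ hξ =>
  hη ξ (h a hξ)

theorem QRel.neg_eq_top_iff {R : QRel Γ} : R.neg = ⊤ ↔ R = ⊥ := by
  constructor
  · intro h
    funext a
    have := congrFun h a
    rw [QRel.neg_apply] at this
    simpa using this
  · rintro rfl
    funext a
    rw [QRel.neg_apply]
    simp

end FunctionalInner

/-! ### The Sasaki arrow -/

section Sasaki

variable {n : ℕ} {Γ : Fin n → QSet.{u, v}} {φ ψ : Formula Γ} {a : ∀ i, (Γ i).At}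

attribute [local instance] functionalNormed functionalInnerProductSpace

theorem Formula.interp_imp :
    (φ.imp ψ).interp a = (φ.interp a ⊓ (φ.interp a ⊓ ψ.interp a)ᗮ)ᗮ := by
  change QRel.neg (QRel.neg (QRel.neg φ.interp) ⊓ QRel.neg (φ.interp ⊓ ψ.interp)) a = _
  rw [QRel.neg_neg, QRel.neg_apply, Pi.inf_apply, QRel.neg_apply, Pi.inf_apply]

/-- Inside `φ`, split `ξ = y + z` with `y` in `φ ∧ ψ` and `z` orthogonal to it. The Sasaki arrow is
the orthocomplement of the space where `z` lives, so `⟨z, y + z⟩ = 0`, which forces `z = 0`. -/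
theorem Formula.modus_ponens {ξ : Functional Γ a} (h : ξ ∈ (φ.imp ψ).interp a)
    (hξ : ξ ∈ φ.interp a) : ξ ∈ ψ.interp a := by
  rw [Formula.interp_imp] at h
  have hle : φ.interp a ⊓ ψ.interp a ≤ φ.interp a := inf_le_left
  rw [← Submodule.sup_orthogonal_inf_of_hasOrthogonalProjection hle] at hξ
  obtain ⟨y, hy, z, hz, rfl⟩ := Submodule.mem_sup.1 hξ
  have h1 : ⟪z, y + z⟫_ℂ = 0 := h z ⟨hz.2, hz.1⟩
  rw [inner_add_right, Submodule.inner_left_of_mem_orthogonal hy hz.1, zero_add,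
    inner_self_eq_zero] at h1
  rw [h1, add_zero]
  exact hy.2

/-- The arrow is the join of `φ ∧ ψ` and `¬φ`. This form serves to prove membership by splitting off
a projection onto `φ`. -/
theorem Formula.add_mem_interp_imp {ξ ζ : Functional Γ a} (h1 : ξ ∈ φ.interp a)
    (h2 : ξ ∈ ψ.interp a) (h3 : ζ ∈ φ.interp.neg a) : ξ + ζ ∈ (φ.imp ψ).interp a := by
  rw [Formula.interp_imp]
  rw [QRel.neg_apply] at h3
  intro z hz
  rw [inner_add_right, Submodule.inner_left_of_mem_orthogonal (Submodule.mem_inf.2 ⟨h1, h2⟩) hz.2,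
    Submodule.inner_right_of_mem_orthogonal hz.1 h3, add_zero]

theorem Formula.interp_imp_eq_top_iff : (φ.imp ψ).interp = ⊤ ↔ φ.interp ≤ ψ.interp := by
  constructor
  · intro h a ξ hξ
    exact Formula.modus_ponens (by rw [h]; trivial) hξ
  · intro h
    funext a
    rw [Formula.interp_imp, inf_eq_left.2 (h a), Submodule.inf_orthogonal_eq_bot]
    simp

end Sasaki

/-! ### Adding a variable in front -/

section Cons

variable {n : ℕ} {Δ : Fin (n + 1) → QSet.{u, v}} {a : ∀ i, (Δ i).At}

/-- The product `ρ ⊗ η` of a functional in the first variable and one in the others. -/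
noncomputable def Functional.cons (ρ : (Δ 0).H (a 0) →ₗ[ℂ] ℂ)
    (η : Functional (fun i : Fin n => Δ i.succ) fun i => a i.succ) : Functional Δ a :=
  LinearMap.uncurryLeft (ρ.smulRight η)

theorem Functional.cons_apply (ρ : (Δ 0).H (a 0) →ₗ[ℂ] ℂ)
    (η : Functional (fun i : Fin n => Δ i.succ) fun i => a i.succ) (w : ∀ i, (Δ i).H (a i)) :
    Functional.cons ρ η w = ρ (w 0) * η fun i => w i.succ := rfl

/-- The functional `⟨h, ·⟩`. -/
noncomputable def riesz {E : Type*} [NormedAddCommGroup E] [InnerProductSpace ℂ E] (h : E) :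
    E →ₗ[ℂ] ℂ := innerₛₗ ℂ h

theorem riesz_apply {E : Type*} [NormedAddCommGroup E] [InnerProductSpace ℂ E] (h x : E) :
    riesz h x = ⟪h, x⟫_ℂ := rfl

theorem exists_eq_riesz {E : Type*} [NormedAddCommGroup E] [InnerProductSpace ℂ E]
    [FiniteDimensional ℂ E] (ρ : E →ₗ[ℂ] ℂ) : ∃ h : E, ρ = riesz h := by
  have := FiniteDimensional.complete ℂ E
  refine ⟨(InnerProductSpace.toDual ℂ E).symm ρ.toContinuousLinearMap, ?_⟩
  ext x
  simp [riesz_apply]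

/-- Fixing the first variable at `h` is adjoint to tensoring with `⟨h, ·⟩`. Expanding `h` in the
orthonormal basis separates the first index of the defining sum from the others. -/
theorem functionalInner_cons (h : (Δ 0).H (a 0))
    (η : Functional (fun i : Fin n => Δ i.succ) fun i => a i.succ) (ξ : Functional Δ a) :
    functionalInner (Functional.cons (riesz h) η) ξ = functionalInner η (ξ.curryLeft h) := by
  classical
  have key : ∀ w : ∀ i : Fin n, (Δ i.succ).H (a i.succ), ξ.curryLeft h w =
      ∑ k, ⟪stdOrthonormalBasis ℂ ((Δ 0).H (a 0)) k, h⟫_ℂ *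
        ξ.curryLeft (stdOrthonormalBasis ℂ ((Δ 0).H (a 0)) k) w := by
    intro w
    conv_lhs => rw [← (stdOrthonormalBasis ℂ ((Δ 0).H (a 0))).sum_repr' h]
    simp
  simp only [functionalInner_eq_sum, key, Finset.mul_sum]
  rw [← (Fin.consEquiv fun i => Fin (Module.finrank ℂ ((Δ i).H (a i)))).sum_comp,
    Fintype.sum_prod_type_right]
  refine Finset.sum_congr rfl fun j _ => Finset.sum_congr rfl fun k _ => ?_
  have hw : (fun i : Fin (n + 1) => stdOrthonormalBasis ℂ ((Δ i).H (a i))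
      (Fin.consEquiv (fun i => Fin (Module.finrank ℂ ((Δ i).H (a i)))) (k, j) i)) =
      Fin.cons (stdOrthonormalBasis ℂ ((Δ 0).H (a 0)) k)
        fun i => stdOrthonormalBasis ℂ ((Δ i.succ).H (a i.succ)) (j i) := by
    funext i
    refine Fin.cases rfl (fun i => rfl) i
  rw [hw, Functional.cons_apply, MultilinearMap.curryLeft_apply]
  simp only [Fin.cons_zero, Fin.cons_succ, riesz_apply, map_mul, inner_conj_symm]
  ring

end Cons

/-! ### Slices of relations in context -/

section Slices

variable {ι κ : Type*}

theorem Functional.tmul_apply {Γ : ι ⊕ κ → QSet.{u, v}} {a : ∀ i, (Γ i).At}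
    (ρ : Functional (fun i => Γ (.inl i)) fun i => a (.inl i))
    (τ : Functional (fun k => Γ (.inr k)) fun k => a (.inr k)) (w : ∀ i, (Γ i).H (a i)) :
    Functional.tmul ρ τ w = ρ (fun i => w (.inl i)) * τ fun k => w (.inr k) := rfl

/-- A slice criterion that replaces the span by a pointwise condition. Slicing commutes with linear
combinations; conversely, expanding in a product basis of the remaining variables recovers `ξ` from
finitely many slices. -/
theorem QRel.mem_prod_top_iff [Finite κ] {Γ : ι ⊕ κ → QSet.{u, v}}
    {P : QRel fun i => Γ (.inl i)} {a : ∀ i, (Γ i).At} {ξ : Functional Γ a} :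
    ξ ∈ QRel.prod P ⊤ a ↔ ∀ w : ∀ i, (Γ i).H (a i), ∃ ρ ∈ P fun i => a (.inl i),
      ∀ v : ∀ i, (Γ i).H (a i), (∀ k, v (.inr k) = w (.inr k)) →
        ξ v = ρ fun i => v (.inl i) := by
  classical
  constructor
  · intro h w
    induction h using Submodule.span_induction with
    | mem ξ hξ =>
      obtain ⟨ρ, hρ, τ, -, rfl⟩ := hξ
      refine ⟨(τ fun k => w (.inr k)) • ρ, Submodule.smul_mem _ _ hρ, fun v hv => ?_⟩
      rw [Functional.tmul_apply, smul_apply, smul_eq_mul, mul_comm]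
      simp only [hv]
    | zero => exact ⟨0, Submodule.zero_mem _, fun v _ => rfl⟩
    | add ξ η _ _ hξ hη =>
      obtain ⟨ρ, hρ, h1⟩ := hξ
      obtain ⟨τ, hτ, h2⟩ := hη
      exact ⟨ρ + τ, Submodule.add_mem _ hρ hτ, fun v hv => by
        rw [add_apply, add_apply, h1 v hv, h2 v hv]⟩
    | smul c ξ _ hξ =>
      obtain ⟨ρ, hρ, h1⟩ := hξ
      exact ⟨c • ρ, Submodule.smul_mem _ _ hρ, fun v hv => by
        rw [smul_apply, smul_apply, h1 v hv]⟩
  · intro h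
    cases nonempty_fintype κ
    let e : ∀ k, Module.Basis (Fin (Module.finrank ℂ ((Γ (.inr k)).H (a (.inr k))))) ℂ
      ((Γ (.inr k)).H (a (.inr k))) := fun k => (stdOrthonormalBasis ℂ _).toBasis
    let J := ∀ k : κ, Fin (Module.finrank ℂ ((Γ (.inr k)).H (a (.inr k))))
    let w : J → ∀ i, (Γ i).H (a i) := fun j i => Sum.rec (motive := fun i => (Γ i).H (a i))
      (fun i => 0) (fun k => e k (j k)) i
    choose ρ hρ hw using fun j => h (w j)
    -- Products of coordinate functionals are dual to the basis tuples, so `∑ ρ j ⊗ τ j` has the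
    -- same slice as `ξ` at every basis tuple.
    let τ : J → Functional (fun k => Γ (.inr k)) fun k => a (.inr k) := fun j =>
      (MultilinearMap.mkPiAlgebra ℂ κ ℂ).compLinearMap fun k => (e k).coord (j k)
    have hτ : ∀ j l : J, τ j (fun k => e k (l k)) = if j = l then 1 else 0 := by
      intro j l
      simp only [τ, MultilinearMap.compLinearMap_apply, MultilinearMap.mkPiAlgebra_apply,
        Module.Basis.coord_apply, Module.Basis.repr_self, Finsupp.single_apply]
      rw [Finset.prod_ite_zero]
      simp [show (j = l) ↔ ∀ k, j k = l k from funext_iff, eq_comm]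
    have hξ : ξ = ∑ j, Functional.tmul (ρ j) (τ j) := by
      apply MultilinearMap.currySumEquiv.injective
      ext1 x
      refine Module.Basis.ext_multilinear e fun l => ?_
      have h1 : (∑ j, Functional.tmul (ρ j) (τ j))
          (Sum.rec (motive := fun i => (Γ i).H (a i)) x fun k => e k (l k)) = ρ l x := by
        rw [sum_apply, Finset.sum_eq_single l]
        · simp [Functional.tmul_apply, hτ]
        · intro j _ hj
          simp [Functional.tmul_apply, hτ, hj]
        · simp
      refine Eq.trans ?_ h1.symm
      exact hw l (Sum.rec (motive := fun i => (Γ i).H (a i)) x fun k => e k (l k)) fun k => rfl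
    rw [hξ]
    exact Submodule.sum_mem _ fun j _ => Submodule.subset_span ⟨ρ j, hρ j, τ j, trivial, rfl⟩

theorem QRel.mem_perm_iff {Γ : ι → QSet.{u, v}} {π : κ ≃ ι} {R : QRel fun k => Γ (π k)}
    {a : ∀ i, (Γ i).At} {ξ : Functional Γ a} :
    ξ ∈ QRel.perm π R a ↔ ∃ ρ ∈ R fun k => a (π k), ∀ v, ξ v = ρ fun k => v (π k) := by
  constructor
  · rintro ⟨ρ, hρ, rfl⟩
    exact ⟨ρ, hρ, fun v => rfl⟩
  · rintro ⟨ρ, hρ, h⟩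
    refine ⟨ρ, hρ, ?_⟩
    ext v
    exact (h v).symm

theorem QRel.exists_comp_eq {Γ : ι → QSet.{u, v}} (π : κ ≃ ι) {a : ∀ i, (Γ i).At}
    (ξ : Functional Γ a) : ∃ ρ : Functional (fun k => Γ (π k)) fun k => a (π k),
      ∀ v, ξ v = ρ fun k => v (π k) := by
  obtain ⟨ρ, rfl⟩ := (MultilinearMap.domDomCongrLinearEquiv' ℂ ℂ (fun i => (Γ i).H (a i)) ℂ
      π.symm).symm.surjective ξ
  exact ⟨ρ, fun v => rfl⟩

/-- The slice criterion carried along the permutation that brings the used variables to the front.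
All atomic formulas are analysed through it. -/
theorem QRel.mem_inContext_iff [Finite ι] {Γ : ι → QSet.{u, v}} {x : κ ↪ ι}
    {R : QRel fun k => Γ (x k)} {a : ∀ i, (Γ i).At} {ξ : Functional Γ a} :
    ξ ∈ QRel.inContext x R a ↔ ∀ w : ∀ i, (Γ i).H (a i), ∃ ρ ∈ R fun k => a (x k),
      ∀ v : ∀ i, (Γ i).H (a i), (∀ i, i ∉ Set.range x → v i = w i) →
        ξ v = ρ fun k => v (x k) := by
  have hsurj : ∀ w : ∀ s, (Γ (completion x s)).H (a (completion x s)),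
      ∃ v : ∀ i, (Γ i).H (a i), w = fun s => v (completion x s) := fun w => by
    obtain ⟨v, rfl⟩ := (Equiv.piCongrLeft' (fun i => (Γ i).H (a i)) (completion x).symm).surjective w
    exact ⟨v, rfl⟩
  unfold QRel.inContext
  rw [QRel.mem_perm_iff]
  constructor
  · rintro ⟨ζ, hζ, h⟩ w
    obtain ⟨ρ, hρ, h1⟩ := QRel.mem_prod_top_iff.1 hζ fun s => w (completion x s)
    refine ⟨ρ, hρ, fun v hv => ?_⟩
    rw [h, h1 _ fun i => hv _ i.2]
    rfl
  · intro h
    obtain ⟨ζ, hζ⟩ := QRel.exists_comp_eq (completion x) ξ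
    refine ⟨ζ, QRel.mem_prod_top_iff.2 fun w => ?_, hζ⟩
    obtain ⟨w, rfl⟩ := hsurj w
    obtain ⟨ρ, hρ, h1⟩ := h w
    refine ⟨ρ, hρ, fun v hv => ?_⟩
    obtain ⟨v, rfl⟩ := hsurj v
    rw [← hζ, h1 v fun i hi => hv ⟨i, hi⟩]
    rfl

end Slices

/-! ### Quantifiers -/

section Quantifiers

theorem Functional.sum_cons_curryLeft {n : ℕ} {Δ : Fin (n + 1) → QSet.{u, v}}
    {a : ∀ i, (Δ i).At} (ξ : Functional Δ a) :
    ξ = ∑ k, Functional.cons (riesz (stdOrthonormalBasis ℂ ((Δ 0).H (a 0)) k))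
      (ξ.curryLeft (stdOrthonormalBasis ℂ ((Δ 0).H (a 0)) k)) := by
  ext w
  have h : ξ w = ξ.curryLeft (w 0) fun i => w i.succ := by
    rw [MultilinearMap.curryLeft_apply]
    congr 1
    exact (Fin.cons_self_tail w).symm
  rw [h, sum_apply]
  conv_lhs => rw [← (stdOrthonormalBasis ℂ ((Δ 0).H (a 0))).sum_repr' (w 0)]
  simp [Functional.cons_apply, riesz_apply]

variable {n : ℕ} {Γ : Fin n → QSet.{u, v}} {X : QSet.{u, v}}
  {φ : Formula (Fin.cons X Γ : Fin (n + 1) → QSet.{u, v})}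

/-- The greatest relation `R` with `⊤ × R ≤ S`. -/
def QRel.forallRel (S : QRel (Fin.cons X Γ : Fin (n + 1) → QSet.{u, v})) : QRel Γ := fun a =>
  { carrier := {η | ∀ (a₀ : X.At) (ρ : X.H a₀ →ₗ[ℂ] ℂ),
      Functional.cons (Δ := Fin.cons X Γ) (a := Fin.cons a₀ a) ρ η ∈ S (Fin.cons a₀ a)}
    zero_mem' := fun a₀ ρ => by
      convert Submodule.zero_mem _
      ext w
      exact mul_zero _
    add_mem' := fun {η ζ} hη hζ a₀ ρ => by
      convert Submodule.add_mem _ (hη a₀ ρ) (hζ a₀ ρ)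
      ext w
      exact mul_add _ _ _
    smul_mem' := fun c η hη a₀ ρ => by
      convert Submodule.smul_mem _ c (hη a₀ ρ)
      ext w
      exact mul_left_comm _ _ _ }

theorem Formula.interp_all : (Formula.all X φ).interp = QRel.forallRel φ.interp := by
  change sSup {R | QRel.topProd X R ≤ φ.interp} = _
  refine IsLUB.sSup_eq (IsGreatest.isLUB ⟨?_, ?_⟩)
  · intro a ξ hξ
    obtain ⟨a₀, a, rfl⟩ : ∃ (a₀ : X.At) (a' : ∀ i, (Γ i).At), a = Fin.cons a₀ a' :=
      ⟨a 0, fun i => a i.succ, (Fin.cons_self_tail a).symm⟩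
    rw [Functional.sum_cons_curryLeft ξ]
    refine Submodule.sum_mem _ fun k _ => ?_
    obtain ⟨ρ, hρ, h⟩ := QRel.mem_inContext_iff.1 hξ
      (Fin.cons (stdOrthonormalBasis ℂ (X.H a₀) k) 0)
    -- The first variable is the only one missing from the range of `Fin.succEmb`, so the slice
    -- through a basis vector is the curried functional.
    have : ρ = ξ.curryLeft (stdOrthonormalBasis ℂ (X.H a₀) k) := by
      ext w
      refine (h (Fin.cons (stdOrthonormalBasis ℂ (X.H a₀) k) w) fun i hi => ?_).symm
      induction i using Fin.cases with
      | zero => rfl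
      | succ i => exact absurd ⟨i, rfl⟩ hi
    have h2 := hρ a₀ (riesz (stdOrthonormalBasis ℂ (X.H a₀) k))
    rw [this] at h2
    exact h2
  · intro R hR a η hη a₀ ρ
    -- Maximality: every slice of `ρ ⊗ η` is a multiple of `η`, so the product already belongs to `⊤
    -- × R`.
    refine hR _ (QRel.mem_inContext_iff.2 fun w => ⟨ρ (w 0) • η, Submodule.smul_mem _ _ hη,
      fun w' hw' => ?_⟩)
    have h0 : w' 0 = w 0 := hw' 0 (by rintro ⟨i, hi⟩; exact Fin.succ_ne_zero i hi)
    exact congrArg (fun x : X.H a₀ => ρ x * η fun i => w' i.succ) h0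

theorem Formula.interp_all_eq_top_iff : (Formula.all X φ).interp = ⊤ ↔ φ.interp = ⊤ := by
  rw [Formula.interp_all]
  constructor
  · intro h
    funext a
    refine eq_top_iff.2 fun ξ _ => ?_
    obtain ⟨a₀, a, rfl⟩ : ∃ (a₀ : X.At) (a' : ∀ i, (Γ i).At), a = Fin.cons a₀ a' :=
      ⟨a 0, fun i => a i.succ, (Fin.cons_self_tail a).symm⟩
    rw [Functional.sum_cons_curryLeft ξ]
    refine Submodule.sum_mem _ fun k _ => ?_
    have : ξ.curryLeft (stdOrthonormalBasis ℂ (X.H a₀) k) ∈ QRel.forallRel φ.interp a := by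
      rw [h]
      trivial
    exact this a₀ (riesz (stdOrthonormalBasis ℂ (X.H a₀) k))
  · intro h
    funext a
    refine eq_top_iff.2 fun η _ a₀ ρ => ?_
    rw [h]
    trivial

end Quantifiers

/-! ### Atomic formulas with two variables -/

section Atoms

/-- Once the equality of arities is substituted, everything is the identity. Phrasing the comparison
with heterogeneous equality keeps casts out of the later arguments. -/
theorem QRel.exists_equiv_recast {ι : Type*} {Γ Δ : ι → QSet.{u, v}} (h : ∀ i, Γ i = Δ i)
    (R : QRel Δ) {a : ∀ i, (Γ i).At} {a' : ∀ i, (Δ i).At} (ha : ∀ i, HEq (a i) (a' i)) :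
    ∃ e : Functional Γ a ≃ Functional Δ a',
      (∀ ξ v v', (∀ i, HEq (v i) (v' i)) → ξ v = e ξ v') ∧
        ∀ ξ, ξ ∈ QRel.recast h R a ↔ e ξ ∈ R a' := by
  obtain rfl : Γ = Δ := funext h
  obtain rfl : a = a' := funext fun i => eq_of_heq (ha i)
  refine ⟨Equiv.refl _, fun ξ v v' hv => ?_, fun ξ => Iff.rfl⟩
  obtain rfl : v = v' := funext fun i => eq_of_heq (hv i)
  rfl

variable {A B : QSet.{u, v}}

/-- A pair of atoms. -/
def pairAt (α : A.At) (β : B.At) : ∀ k, ((![A, B] : Fin 2 → QSet.{u, v}) k).At :=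
  Fin.cons α (Fin.cons β finZeroElim)

/-- A pair of vectors. -/
def pairVec {α : A.At} {β : B.At} (x : A.H α) (y : B.H β) :
    ∀ k, ((![A, B] : Fin 2 → QSet.{u, v}) k).H (pairAt α β k) :=
  Fin.cons x (Fin.cons y finZeroElim)

theorem exists_eq_pairAt (a : ∀ k, ((![A, B] : Fin 2 → QSet.{u, v}) k).At) :
    ∃ (α : A.At) (β : B.At), a = pairAt α β := by
  refine ⟨a 0, a 1, ?_⟩
  funext k
  fin_cases k <;> rfl

theorem exists_eq_pairVec {α : A.At} {β : B.At}
    (w : ∀ k, ((![A, B] : Fin 2 → QSet.{u, v}) k).H (pairAt α β k)) :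
    ∃ (x : A.H α) (y : B.H β), w = pairVec x y := by
  refine ⟨w 0, w 1, ?_⟩
  funext k
  fin_cases k <;> rfl

/-- The bilinear forms of a relation of arity two, as functions of two variables. -/
def QRel.forms (R : QRel ![A, B]) (α : A.At) (β : B.At) :
    Submodule ℂ (A.H α → B.H β → ℂ) :=
  (R (pairAt α β)).map
    ({ toFun := fun ξ x y => ξ (pairVec x y)
       map_add' := fun _ _ => rfl
       map_smul' := fun _ _ => rfl } : Functional ![A, B] (pairAt α β) →ₗ[ℂ] A.H α → B.H β → ℂ)

theorem QRel.mem_forms {R : QRel ![A, B]} {α : A.At} {β : B.At} {m : A.H α → B.H β → ℂ} :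
    m ∈ R.forms α β ↔ ∃ ξ ∈ R (pairAt α β), ∀ x y, m x y = ξ (pairVec x y) := by
  constructor
  · rintro ⟨ξ, hξ, rfl⟩
    exact ⟨ξ, hξ, fun _ _ => rfl⟩
  · rintro ⟨ξ, hξ, h⟩
    exact ⟨ξ, hξ, by funext x y; exact (h x y).symm⟩

theorem QRel.mem_iff_forms {R : QRel ![A, B]} {α : A.At} {β : B.At}
    {ξ : Functional ![A, B] (pairAt α β)} :
    ξ ∈ R (pairAt α β) ↔ (fun x y => ξ (pairVec x y)) ∈ R.forms α β := by
  rw [QRel.mem_forms]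
  refine ⟨fun h => ⟨ξ, h, fun _ _ => rfl⟩, ?_⟩
  rintro ⟨ζ, hζ, h⟩
  convert hζ
  ext w
  obtain ⟨x, y, rfl⟩ := exists_eq_pairVec w
  exact h _ _

theorem QRel.ext_forms {R S : QRel ![A, B]} (h : ∀ α β, R.forms α β = S.forms α β) : R = S := by
  funext a
  obtain ⟨α, β, rfl⟩ := exists_eq_pairAt a
  ext ξ
  rw [QRel.mem_iff_forms, QRel.mem_iff_forms, h]

theorem Formula.mem_interp_atom₂ {n : ℕ} {Γ : Fin n → QSet.{u, v}} {i j : Fin n} (hij : i ≠ j)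
    (R : QRel ![Γ i, Γ j]) {a : ∀ k, (Γ k).At} {ξ : Functional Γ a} :
    ξ ∈ (Formula.atom₂ R i j hij rfl rfl).interp a ↔
      ∀ w : ∀ k, (Γ k).H (a k), ∃ m ∈ R.forms (a i) (a j),
        ∀ v : ∀ k, (Γ k).H (a k), (∀ k, k ≠ i → k ≠ j → v k = w k) → ξ v = m (v i) (v j) := by
  have hx : ∀ k, HEq (a (![i, j] k)) (pairAt (a i) (a j) k) := fun k => by
    fin_cases k <;> rfl
  have hv : ∀ (v : ∀ k, (Γ k).H (a k)) k, HEq (v (![i, j] k)) (pairVec (v i) (v j) k) :=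
    fun v k => by fin_cases k <;> rfl
  have hr : ∀ k, k ∉ Set.range ![i, j] ↔ k ≠ i ∧ k ≠ j := fun k => by
    simp [eq_comm, and_comm]
  obtain ⟨e, he, hR⟩ := QRel.exists_equiv_recast (Γ := fun k => Γ (![i, j] k))
    (Fin.forall_fin_two.mpr ⟨rfl, rfl⟩) R hx
  refine QRel.mem_inContext_iff.trans (forall_congr' fun w => ?_)
  constructor
  · rintro ⟨ρ, hρ, h⟩
    refine ⟨_, QRel.mem_forms.2 ⟨e ρ, (hR ρ).1 hρ, fun x y => rfl⟩, fun v hvw => ?_⟩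
    rw [h v fun k hk => hvw k ((hr k).1 hk).1 ((hr k).1 hk).2]
    exact he ρ _ _ (hv v)
  · rintro ⟨m, hm, h⟩
    obtain ⟨ζ, hζ, h1⟩ := QRel.mem_forms.1 hm
    obtain ⟨ρ, rfl⟩ := e.surjective ζ
    refine ⟨ρ, (hR ρ).2 hζ, fun v hvw => ?_⟩
    rw [h v fun k h1 h2 => hvw k ((hr k).2 ⟨h1, h2⟩), h1]
    exact (he ρ _ _ (hv v)).symm

/-- Meant for the concrete nested contexts of the sentences, where the sorts agree with `A` and `B`
by computation and the heterogeneous hypotheses close by `HEq.rfl`. -/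
theorem Formula.mem_interp_atom₂_heq {n : ℕ} {Γ : Fin n → QSet.{u, v}} {i j : Fin n}
    (hij : i ≠ j) (hi : Γ i = A) (hj : Γ j = B) (R : QRel ![A, B]) {a : ∀ k, (Γ k).At}
    {α : A.At} {β : B.At} (hα : HEq (a i) α) (hβ : HEq (a j) β) {ξ : Functional Γ a} :
    ξ ∈ (Formula.atom₂ R i j hij hi hj).interp a ↔
      ∀ w : ∀ k, (Γ k).H (a k), ∃ m ∈ R.forms α β,
        ∀ (v : ∀ k, (Γ k).H (a k)) (x : A.H α) (y : B.H β), HEq (v i) x → HEq (v j) y →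
          (∀ k, k ≠ i → k ≠ j → v k = w k) → ξ v = m x y := by
  subst hi hj hα hβ
  refine (Formula.mem_interp_atom₂ hij R).trans (forall_congr' fun w => exists_congr fun m =>
    and_congr_right fun _ => ⟨?_, fun h v => h v _ _ HEq.rfl HEq.rfl⟩)
  rintro h v _ _ ⟨⟩ ⟨⟩
  exact h v

end Atoms

/-! ### The pairing of an atom with its dual -/

section Pairing

variable (X : QSet.{u, v}) {a : X.At}

namespace QSet

/-- The pairing of `X_a^*` with `X_a`. -/
noncomputable def pairing (a : X.At) : X.dual.H (X.dualAtom a) →ₗ[ℂ] X.H a →ₗ[ℂ] ℂ :=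
  ContinuousLinearMap.coeLM ℂ (M := X.H a) (N₃ := ℂ)

/-- The element `⟨x, ·⟩` of `X_a^*`. -/
noncomputable def flat (x : X.H a) : X.dual.H (X.dualAtom a) := InnerProductSpace.toDual ℂ (X.H a) x

/-- The vector `x` with `η = ⟨x, ·⟩`. -/
noncomputable def sharp (η : X.dual.H (X.dualAtom a)) : X.H a := (InnerProductSpace.toDual ℂ (X.H a)).symm η

theorem pairing_flat (x y : X.H a) : X.pairing a (X.flat x) y = ⟪x, y⟫_ℂ := rfl

theorem flat_sharp (η : X.dual.H (X.dualAtom a)) : X.flat (X.sharp η) = η :=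
  (InnerProductSpace.toDual ℂ (X.H a)).apply_symm_apply η

theorem sharp_flat (x : X.H a) : X.sharp (X.flat x) = x :=
  (InnerProductSpace.toDual ℂ (X.H a)).symm_apply_apply x

theorem inner_dual (η ζ : X.dual.H (X.dualAtom a)) : ⟪η, ζ⟫_ℂ = ⟪X.sharp ζ, X.sharp η⟫_ℂ := rfl

theorem inner_sharp (η : X.dual.H (X.dualAtom a)) (x : X.H a) : ⟪X.sharp η, x⟫_ℂ = X.pairing a η x := by
  rw [← pairing_flat, flat_sharp]

theorem inner_flat (x : X.H a) (η : X.dual.H (X.dualAtom a)) : ⟪X.flat x, η⟫_ℂ = X.pairing a η x := by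
  rw [inner_dual, sharp_flat, inner_sharp]

theorem eq_zero_of_pairing {x : X.H a} (h : ∀ η, X.pairing a η x = 0) : x = 0 := by
  have := h (X.flat x)
  rwa [pairing_flat, inner_self_eq_zero] at this

theorem eq_of_pairing {x y : X.H a} (h : ∀ η, X.pairing a η x = X.pairing a η y) : x = y := by
  rw [← sub_eq_zero]
  refine X.eq_zero_of_pairing fun η => ?_
  rw [map_sub, h, sub_self]

end QSet

end Pairing

/-! ### Identity relations -/

section Identity

variable {X : QSet.{u, v}} {a b : X.At}

theorem BinRel.mem_id_self {f : X.H a →ₗ[ℂ] X.H a} :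
    f ∈ BinRel.id X a a ↔ ∃ c : ℂ, f = c • LinearMap.id := by
  constructor
  · intro h
    induction h using Submodule.span_induction with
    | mem f hf =>
      obtain ⟨_, hf⟩ := hf
      exact ⟨1, by ext x; simp [hf]⟩
    | zero => exact ⟨0, by simp⟩
    | add f g _ _ hf hg =>
      obtain ⟨c, rfl⟩ := hf
      obtain ⟨d, rfl⟩ := hg
      exact ⟨c + d, by rw [add_smul]⟩
    | smul r f _ hf =>
      obtain ⟨c, rfl⟩ := hf
      exact ⟨r * c, by rw [mul_smul]⟩
  · rintro ⟨c, rfl⟩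
    exact Submodule.smul_mem _ _ (Submodule.subset_span ⟨rfl, fun x => rfl⟩)

theorem BinRel.mem_id_of_ne (h : a ≠ b) {f : X.H a →ₗ[ℂ] X.H b} :
    f ∈ BinRel.id X a b ↔ f = 0 := by
  have : BinRel.id X a b = ⊥ := by
    rw [BinRel.id, Submodule.span_eq_bot]
    rintro f ⟨h', -⟩
    exact absurd h' h
  rw [this, Submodule.mem_bot]

theorem BinRel.mem_evalSpace_self {ε : X.H a ⊗[ℂ] StrongDual ℂ (X.H a) →ₗ[ℂ] ℂ} :
    ε ∈ BinRel.evalSpace X a a ↔ ∃ c : ℂ, ∀ y η, ε (y ⊗ₜ[ℂ] η) = c * X.pairing a η y := by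
  constructor
  · intro h
    induction h using Submodule.span_induction with
    | mem f hf =>
      obtain ⟨_, hf⟩ := hf
      exact ⟨1, fun y η => by rw [hf, one_mul]; rfl⟩
    | zero => exact ⟨0, by simp⟩
    | add f g _ _ hf hg =>
      obtain ⟨c, hc⟩ := hf
      obtain ⟨d, hd⟩ := hg
      exact ⟨c + d, fun y η => by rw [LinearMap.add_apply, hc, hd, add_mul]⟩
    | smul r f _ hf =>
      obtain ⟨c, hc⟩ := hf
      exact ⟨r * c, fun y η => by rw [LinearMap.smul_apply, hc, smul_eq_mul, mul_assoc]⟩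
  · rintro ⟨c, hc⟩
    have : ε = c • TensorProduct.lift (X.pairing a).flip := by
      refine TensorProduct.ext' fun y η => ?_
      rw [hc]
      rfl
    rw [this]
    exact Submodule.smul_mem _ _ (Submodule.subset_span ⟨rfl, fun x η => rfl⟩)

theorem BinRel.mem_evalSpace_of_ne (h : a ≠ b)
    {ε : X.H a ⊗[ℂ] StrongDual ℂ (X.H b) →ₗ[ℂ] ℂ} :
    ε ∈ BinRel.evalSpace X a b ↔ ε = 0 := by
  have : BinRel.evalSpace X a b = ⊥ := by
    rw [BinRel.evalSpace, Submodule.span_eq_bot]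
    rintro f ⟨h', -⟩
    exact absurd h' h
  rw [this, Submodule.mem_bot]

end Identity

/-! ### Bending -/

section Bend

variable {X Y : QSet.{u, v}}

theorem QRel.mem_forms_ofBin {Z : QSet.{u, v}} {R : BinRel (X.prod Z) QSet.one} {a : X.At}
    {b : Z.At} {m : X.H a → Z.H b → ℂ} :
    m ∈ (QRel.ofBin R).forms a b ↔ ∃ ξ : X.H a ⊗[ℂ] Z.H b →ₗ[ℂ] ℂ,
      ξ ∈ R (X.prodAtom Z a b) QSet.oneAtom ∧ ∀ x z, m x z = ξ (x ⊗ₜ[ℂ] z) := by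
  rw [QRel.mem_forms]
  constructor
  · rintro ⟨_, ⟨ξ, hξ, rfl⟩, h⟩
    exact ⟨ξ, hξ, h⟩
  · rintro ⟨ξ, hξ, h⟩
    exact ⟨_, ⟨ξ, hξ, rfl⟩, h⟩

theorem QRel.mem_forms_equality {b b' : Y.At} {m : Y.H b → Y.dual.H (Y.dualAtom b') → ℂ} :
    m ∈ (QRel.equality Y).forms b (Y.dualAtom b') ↔
      ∃ f ∈ BinRel.id Y b b', ∀ y η, m y η = Y.pairing b' η (f y) := by
  refine QRel.mem_forms_ofBin.trans ?_
  change (∃ ξ ∈ BinRel.evalSpace Y b b', _) ↔ _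
  by_cases h : b = b'
  · subst h
    constructor
    · rintro ⟨ξ, hξ, h⟩
      obtain ⟨c, hc⟩ := BinRel.mem_evalSpace_self.1 hξ
      refine ⟨c • LinearMap.id, BinRel.mem_id_self.2 ⟨c, rfl⟩, fun y η => ?_⟩
      rw [LinearMap.smul_apply, map_smul]
      exact (h y η).trans (hc y η)
    · rintro ⟨f, hf, h⟩
      obtain ⟨c, rfl⟩ := BinRel.mem_id_self.1 hf
      refine ⟨c • TensorProduct.lift (Y.pairing b).flip, BinRel.mem_evalSpace_self.2
        ⟨c, fun y η => rfl⟩, fun y η => ?_⟩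
      rw [h, LinearMap.smul_apply, map_smul]
      rfl
  · constructor
    · rintro ⟨ξ, hξ, h'⟩
      obtain rfl := (BinRel.mem_evalSpace_of_ne h).1 hξ
      exact ⟨0, Submodule.zero_mem _, fun y η => (h' y η).trans (map_zero _).symm⟩
    · rintro ⟨f, hf, h'⟩
      obtain rfl := (BinRel.mem_id_of_ne h).1 hf
      exact ⟨0, Submodule.zero_mem _, fun y η => (h' y η).trans (map_zero _)⟩

/-- Evaluation and identity both vanish off the diagonal, so a generator of the composite survives
only if the three atoms of `Y` coincide, and then it is a scalar multiple of `f`. -/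
theorem BinRel.exists_eval_comp_map {F : BinRel X Y} {a : X.At} {b b₁ b₂ : Y.At}
    {s : Y.H b₁ ⊗[ℂ] Y.dual.H (Y.dualAtom b₂) →ₗ[ℂ] ℂ} (hs : s ∈ BinRel.evalSpace Y b₁ b₂)
    {f : X.H a →ₗ[ℂ] Y.H b₁} (hf : f ∈ F a b₁)
    {g : Y.dual.H (Y.dualAtom b) →ₗ[ℂ] Y.dual.H (Y.dualAtom b₂)}
    (hg : g ∈ BinRel.id Y.dual (Y.dualAtom b) (Y.dualAtom b₂)) :
    ∃ f' ∈ F a b, ∀ x η, s (f x ⊗ₜ[ℂ] g η) = Y.pairing b η (f' x) := by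
  by_cases h1 : b₁ = b₂
  · subst h1
    by_cases h2 : b = b₁
    · subst h2
      obtain ⟨c, hc⟩ := BinRel.mem_evalSpace_self.1 hs
      obtain ⟨d, rfl⟩ := BinRel.mem_id_self.1 hg
      refine ⟨(c * d) • f, Submodule.smul_mem _ _ hf, fun x η => ?_⟩
      have h3 : Y.pairing b η (((c * d) • f) x) = c * (d * Y.pairing b η (f x)) := by
        rw [LinearMap.smul_apply, map_smul, smul_eq_mul, mul_assoc]
      rw [h3]
      refine (hc (f x) (d • η)).trans (congrArg (c * ·) ?_)
      exact congrArg (· (f x)) ((Y.pairing b).map_smul d η)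
    · obtain rfl := (BinRel.mem_id_of_ne (X := Y.dual) h2).1 hg
      refine ⟨0, Submodule.zero_mem _, fun x η => ?_⟩
      have h3 : s (f x ⊗ₜ[ℂ] (0 : Y.dual.H (Y.dualAtom b₁))) = 0 := by
        rw [TensorProduct.tmul_zero, map_zero]
      exact h3.trans (map_zero (Y.pairing b η)).symm
  · obtain rfl := (BinRel.mem_evalSpace_of_ne h1).1 hs
    exact ⟨0, Submodule.zero_mem _, fun x η => (map_zero (Y.pairing b η)).symm⟩

/-- The dictionary between operators and bilinear forms, through which every later statement about
graphs is read. -/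
theorem QRel.mem_forms_bend {F : BinRel X Y} {a : X.At} {b : Y.At}
    {m : X.H a → Y.dual.H (Y.dualAtom b) → ℂ} :
    m ∈ F.bend.forms a (Y.dualAtom b) ↔
      ∃ f ∈ F a b, ∀ x η, m x η = Y.pairing b η (f x) := by
  refine QRel.mem_forms_ofBin.trans ?_
  constructor
  · rintro ⟨ξ, hξ, h⟩
    suffices ∃ f ∈ F a b, ∀ x η, ξ (x ⊗ₜ[ℂ] η) = Y.pairing b η (f x) by
      obtain ⟨f, hf, h'⟩ := this
      exact ⟨f, hf, fun x η => (h x η).trans (h' x η)⟩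
    clear h
    induction hξ using Submodule.span_induction with
    | mem ξ hξ =>
      obtain ⟨p, s, r, hs, hr, rfl⟩ := hξ
      induction hr using Submodule.span_induction with
      | mem r hr =>
        obtain ⟨f, hf, g, hg, rfl⟩ := hr
        exact BinRel.exists_eval_comp_map hs hf hg
      | zero => exact ⟨0, Submodule.zero_mem _, fun x η =>
          (map_zero s).trans (map_zero (Y.pairing b η)).symm⟩
      | add ξ ζ _ _ hξ hζ =>
        obtain ⟨f, hf, h1⟩ := hξ
        obtain ⟨g, hg, h2⟩ := hζ
        refine ⟨f + g, Submodule.add_mem _ hf hg, fun x η => ?_⟩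
        rw [LinearMap.add_apply, map_add, ← h1, ← h2]
        exact map_add s _ _
      | smul c ξ _ hξ =>
        obtain ⟨f, hf, h1⟩ := hξ
        refine ⟨c • f, Submodule.smul_mem _ _ hf, fun x η => ?_⟩
        rw [LinearMap.smul_apply, map_smul, ← h1]
        exact map_smul s _ _
    | zero => exact ⟨0, Submodule.zero_mem _, fun x η => (map_zero (Y.pairing b η)).symm⟩
    | add ξ ζ _ _ hξ hζ =>
      obtain ⟨f, hf, h1⟩ := hξ
      obtain ⟨g, hg, h2⟩ := hζ
      refine ⟨f + g, Submodule.add_mem _ hf hg, fun x η => ?_⟩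
      rw [LinearMap.add_apply, map_add, ← h1, ← h2]
      rfl
    | smul c ξ _ hξ =>
      obtain ⟨f, hf, h1⟩ := hξ
      refine ⟨c • f, Submodule.smul_mem _ _ hf, fun x η => ?_⟩
      rw [LinearMap.smul_apply, map_smul, ← h1]
      rfl
  · rintro ⟨f, hf, h⟩
    refine ⟨TensorProduct.lift (Y.pairing b).flip ∘ₗ TensorProduct.map f LinearMap.id,
      Submodule.subset_span ⟨Y.prodAtom Y.dual b (Y.dualAtom b), _, _, ?_, Submodule.subset_span ⟨f, hf, LinearMap.id,
        ?_, rfl⟩, rfl⟩, fun x η => ?_⟩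
    · exact BinRel.mem_evalSpace_self.2 ⟨1, fun y η => (one_mul _).symm⟩
    · exact BinRel.mem_id_self.2 ⟨1, (one_smul _ _).symm⟩
    · rw [h]
      rfl

theorem Functional.exists_bilinear {A B : QSet.{u, v}} {α : A.At} {β : B.At}
    (ξ : Functional ![A, B] (pairAt α β)) :
    ∃ L : A.H α →ₗ[ℂ] B.H β →ₗ[ℂ] ℂ, ∀ x y, L x y = ξ (pairVec x y) := by
  have h0 : ∀ (x : A.H α) (y : B.H β),
      Function.update (pairVec (A := A) (α := α) 0 y) 0 x = pairVec x y := fun x y => by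
    funext k
    fin_cases k <;> rfl
  have h1 : ∀ (x : A.H α) (y : B.H β),
      Function.update (pairVec (B := B) (β := β) x 0) 1 y = pairVec x y := fun x y => by
    funext k
    fin_cases k <;> rfl
  refine ⟨LinearMap.mk₂ ℂ (fun x y => ξ (pairVec x y)) ?_ ?_ ?_ ?_, fun x y => rfl⟩
  · intro x x' y
    have := ξ.map_update_add (pairVec 0 y) 0 x x'
    rw [← h0 x, ← h0 x', ← this]
    exact congrArg ξ (h0 _ _).symm
  · intro c x y
    have := ξ.map_update_smul (pairVec 0 y) 0 c x
    rw [← h0 x, ← this]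
    exact congrArg ξ (h0 _ _).symm
  · intro x y y'
    have := ξ.map_update_add (pairVec x 0) 1 y y'
    rw [← h1 x y, ← h1 x y', ← this]
    exact congrArg ξ (h1 _ _).symm
  · intro c x y
    have := ξ.map_update_smul (pairVec x 0) 1 c y
    rw [← h1 x y, ← this]
    exact congrArg ξ (h1 _ _).symm

theorem QSet.sum_pairing_smul_flat (b : Y.At) (η : Y.dual.H (Y.dualAtom b)) :
    ∑ k, Y.pairing b η (stdOrthonormalBasis ℂ (Y.H b) k) •
      Y.flat (stdOrthonormalBasis ℂ (Y.H b) k) = η := by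
  have h : ∀ y, Y.pairing b (∑ k, Y.pairing b η (stdOrthonormalBasis ℂ (Y.H b) k) •
      Y.flat (stdOrthonormalBasis ℂ (Y.H b) k)) y = Y.pairing b η y := fun y => by
    conv_rhs => rw [← (stdOrthonormalBasis ℂ (Y.H b)).sum_repr' y]
    simp only [map_sum, map_smul, LinearMap.sum_apply, LinearMap.smul_apply, QSet.pairing_flat,
      smul_eq_mul, mul_comm]
  exact DFunLike.ext (F := StrongDual ℂ (Y.H b)) _ _ h

/-- Take for `F` the operators whose form lies in `G`. Nothing is lost: in finite dimension a form
`L` on `X_a × Y_b^*` comes from the operator `x ↦ ∑ L(x, ⟨e_k, ·⟩) e_k`, for an orthonormal basis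
`e_k` of `Y_b`. -/
theorem BinRel.exists_bend_eq (G : QRel ![X, Y.dual]) : ∃ F : BinRel X Y, F.bend = G := by
  let F : BinRel X Y := fun a b => (G.forms a (Y.dualAtom b)).comap
    ({ toFun := fun f x η => Y.pairing b η (f x)
       map_add' := fun f g => by funext x η; simp
       map_smul' := fun c f => by funext x η; simp } :
      (X.H a →ₗ[ℂ] Y.H b) →ₗ[ℂ] X.H a → Y.dual.H (Y.dualAtom b) → ℂ)
  have hF : ∀ a b, F.bend.forms a (Y.dualAtom b) = G.forms a (Y.dualAtom b) := by
    intro a b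
    ext m
    refine QRel.mem_forms_bend.trans ⟨?_, fun hm => ?_⟩
    · rintro ⟨f, hf, h⟩
      rw [show m = fun x η => Y.pairing b η (f x) from funext fun x => funext fun η => h x η]
      exact hf
    · obtain ⟨ξ, hξ, h⟩ := QRel.mem_forms.1 hm
      obtain ⟨L, hL⟩ := ξ.exists_bilinear
      have hf : ∀ (x : X.H a) (η : Y.dual.H (Y.dualAtom b)), m x η =
          Y.pairing b η ((∑ k, (L.flip (Y.flat (stdOrthonormalBasis ℂ (Y.H b) k))).smulRight
            (stdOrthonormalBasis ℂ (Y.H b) k)) x) := fun x η => by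
        refine ((h x η).trans (hL x η).symm).trans ?_
        conv_lhs => rw [← Y.sum_pairing_smul_flat b η]
        simp only [map_sum, LinearMap.sum_apply, LinearMap.smulRight_apply, map_smul,
          LinearMap.flip_apply, smul_eq_mul, mul_comm]
      refine ⟨_, ?_, hf⟩
      rw [show m = fun x η => _ from funext fun x => funext fun η => hf x η] at hm
      exact hm
  exact ⟨F, QRel.ext_forms hF⟩

theorem BinRel.bend_injective : Function.Injective (BinRel.bend (X := X) (Y := Y)) := by
  intro F F' h
  have key : ∀ F F' : BinRel X Y, F.bend = F'.bend → F ≤ F' := fun F F' h a b f hf => by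
    have h1 : (fun x η => Y.pairing b η (f x)) ∈ F'.bend.forms a (Y.dualAtom b) := by
      rw [← h]
      exact QRel.mem_forms_bend.2 ⟨f, hf, fun _ _ => rfl⟩
    obtain ⟨g, hg, h2⟩ := QRel.mem_forms_bend.1 h1
    have : f = g := by
      ext x
      exact Y.eq_of_pairing fun η => h2 x η
    rwa [this]
  exact le_antisymm (key F F' h) (key F' F h.symm)

theorem QRel.mem_forms_conjDual {G : QRel ![X, Y.dual]} {a : X.At} {b : Y.At}
    {m : X.dual.H (X.dualAtom a) → Y.H b → ℂ} :
    m ∈ G.conjDual.forms (X.dualAtom a) b ↔ ∃ m' ∈ G.forms a (Y.dualAtom b),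
      ∀ ζ y, m ζ y = conj (m' (X.sharp ζ) (Y.flat y)) := by
  -- The canonical bidual embedding followed by the inverse Riesz map of `Y_b^*` is the Riesz map of
  -- `Y_b`.
  have hb : ∀ y : Y.H b, (InnerProductSpace.toDual ℂ (Y.dual.H (Y.dualAtom b))).symm
      (Y.toBidual b y) = Y.flat y := fun y => by
    refine (LinearIsometryEquiv.symm_apply_eq _).2 (DFunLike.ext
      (F := StrongDual ℂ (Y.dual.H (Y.dualAtom b))) _ _ fun η => ?_)
    exact (Y.inner_flat y η).symm
  rw [QRel.mem_forms]
  constructor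
  · rintro ⟨_, ⟨_, ⟨ξ, hξ, rfl⟩, rfl⟩, h⟩
    refine ⟨_, QRel.mem_forms.2 ⟨ξ, hξ, fun _ _ => rfl⟩, fun ζ y => (h ζ y).trans ?_⟩
    refine congrArg (fun w => conj (ξ w)) ?_
    funext k
    fin_cases k
    · rfl
    · exact hb y
  · rintro ⟨m', hm', h⟩
    obtain ⟨ξ, hξ, h'⟩ := QRel.mem_forms.1 hm'
    refine ⟨_, ⟨_, ⟨ξ, hξ, rfl⟩, rfl⟩, fun ζ y => (h ζ y).trans ?_⟩
    rw [h']
    refine congrArg (fun w => conj (ξ w)) ?_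
    funext k
    fin_cases k
    · rfl
    · exact (hb y).symm

/-- Conjugating a graph is taking adjoints: the conjugate of `⟨y, f x⟩` is `⟨x, f† y⟩`. -/
theorem QRel.mem_forms_conjDual_bend {F : BinRel X Y} {a : X.At} {b : Y.At}
    {m : X.dual.H (X.dualAtom a) → Y.H b → ℂ} :
    m ∈ F.bend.conjDual.forms (X.dualAtom a) b ↔ ∃ f ∈ F a b,
      ∀ ζ y, m ζ y = X.pairing a ζ (LinearMap.adjoint f y) := by
  rw [QRel.mem_forms_conjDual]
  have key : ∀ (f : X.H a →ₗ[ℂ] Y.H b) (ζ : X.dual.H (X.dualAtom a)) (y : Y.H b),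
      conj (Y.pairing b (Y.flat y) (f (X.sharp ζ))) = X.pairing a ζ (LinearMap.adjoint f y) := by
    intro f ζ y
    rw [QSet.pairing_flat, inner_conj_symm, ← LinearMap.adjoint_inner_right, QSet.inner_sharp]
  constructor
  · rintro ⟨m', hm', h⟩
    obtain ⟨f, hf, h'⟩ := QRel.mem_forms_bend.1 hm'
    exact ⟨f, hf, fun ζ y => by rw [h, h', key]⟩
  · rintro ⟨f, hf, h⟩
    exact ⟨_, QRel.mem_forms_bend.2 ⟨f, hf, fun _ _ => rfl⟩, fun ζ y => by rw [h, key]⟩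

end Bend

/-! ### Extended contexts -/

section Extend

variable {n : ℕ} {Γ : Fin n → QSet.{u, v}} {β : ∀ i, (Γ i).At} {X : QSet.{u, v}} {a a' : X.At}

/-- The context `Γ`, extended by a variable of sort `X` in front. -/
abbrev extCtx (X : QSet.{u, v}) (Γ : Fin n → QSet.{u, v}) : Fin (n + 1) → QSet.{u, v} :=
  Fin.cons X Γ

/-- Atoms of an extended context. -/
def extAt (a : X.At) (β : ∀ i, (Γ i).At) : ∀ i, (extCtx X Γ i).At := Fin.cons a β

/-- Vectors of an extended context. -/
def extVec (x : X.H a) (w : ∀ i, (Γ i).H (β i)) : ∀ i, (extCtx X Γ i).H (extAt a β i) :=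
  Fin.cons x w

/-- The product of a functional on `X_a` and one on the other atoms. -/
noncomputable def extFun (ρ : X.H a →ₗ[ℂ] ℂ) (η : Functional Γ β) :
    Functional (extCtx X Γ) (extAt a β) :=
  Functional.cons (Δ := extCtx X Γ) (a := extAt a β) ρ η

/-- The functional obtained by fixing the first variable. -/
noncomputable def fixFirst (h : X.H a) (ξ : Functional (extCtx X Γ) (extAt a β)) :
    Functional Γ β :=
  MultilinearMap.curryLeft (M := fun i => (extCtx X Γ i).H (extAt a β i)) ξ h

theorem exists_eq_extAt (α : ∀ i, (extCtx X Γ i).At) :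
    ∃ (a : X.At) (β : ∀ i, (Γ i).At), α = extAt a β :=
  ⟨α 0, fun i => α i.succ, (Fin.cons_self_tail α).symm⟩

theorem exists_eq_extVec (w : ∀ i, (extCtx X Γ i).H (extAt a β i)) :
    ∃ (x : X.H a) (w' : ∀ i, (Γ i).H (β i)), w = extVec x w' :=
  ⟨w 0, fun i => w i.succ, (Fin.cons_self_tail w).symm⟩

theorem extFun_apply (ρ : X.H a →ₗ[ℂ] ℂ) (η : Functional Γ β) (x : X.H a)
    (w : ∀ i, (Γ i).H (β i)) : extFun ρ η (extVec x w) = ρ x * η w := rfl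

theorem fixFirst_apply (h : X.H a) (ξ : Functional (extCtx X Γ) (extAt a β))
    (w : ∀ i, (Γ i).H (β i)) : fixFirst h ξ w = ξ (extVec h w) := rfl

theorem functionalInner_extFun (h : X.H a) (η : Functional Γ β)
    (ξ : Functional (extCtx X Γ) (extAt a β)) :
    functionalInner (extFun (riesz h) η) ξ = functionalInner η (fixFirst h ξ) :=
  functionalInner_cons (Δ := extCtx X Γ) (a := extAt a β) h η ξ

theorem ext_extVec {ξ ζ : Functional (extCtx X Γ) (extAt a β)}
    (h : ∀ x w, ξ (extVec x w) = ζ (extVec x w)) : ξ = ζ := by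
  ext w
  obtain ⟨x, w, rfl⟩ := exists_eq_extVec w
  exact h x w

theorem Formula.mem_interp_all {φ : Formula (extCtx X Γ)} {η : Functional Γ β} :
    η ∈ (Formula.all X φ).interp β ↔
      ∀ (a : X.At) (ρ : X.H a →ₗ[ℂ] ℂ), extFun ρ η ∈ φ.interp (extAt a β) := by
  rw [Formula.interp_all]
  exact Iff.rfl

end Extend

/-! ### Quantification over the diagonal -/

section Diagonal

variable {n : ℕ} {Γ : Fin n → QSet.{u, v}} {β : ∀ i, (Γ i).At} {X : QSet.{u, v}} {a : X.At}

/-- Functionals in the context `(x, x_*, …)`. -/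
abbrev DiagFunctional (a a' : X.At) (β : ∀ i, (Γ i).At) :=
  Functional (extCtx X (extCtx X.dual Γ)) (extAt a (extAt (X.dualAtom a') β))

/-- The contraction of the first variable with the second. -/
noncomputable def contract (ξ : DiagFunctional a a β) : Functional Γ β :=
  ∑ k, fixFirst (X.flat (stdOrthonormalBasis ℂ (X.H a) k))
    (fixFirst (stdOrthonormalBasis ℂ (X.H a) k) ξ)

/-- The product of the evaluation functional on `X_a ⊗ X_a^*` and of `η`. -/
noncomputable def diagFun (a : X.At) (η : Functional Γ β) : DiagFunctional a a β :=
  ∑ k, extFun (riesz (stdOrthonormalBasis ℂ (X.H a) k))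
    (extFun (riesz (X.flat (stdOrthonormalBasis ℂ (X.H a) k))) η)

theorem contract_apply (ξ : DiagFunctional a a β) (w : ∀ i, (Γ i).H (β i)) :
    contract ξ w = ∑ k, ξ (extVec (stdOrthonormalBasis ℂ (X.H a) k)
      (extVec (X.flat (stdOrthonormalBasis ℂ (X.H a) k)) w)) := by
  rw [contract, sum_apply]
  rfl

theorem diagFun_apply (η : Functional Γ β) (x : X.H a) (ζ : X.dual.H (X.dualAtom a))
    (w : ∀ i, (Γ i).H (β i)) :
    diagFun a η (extVec x (extVec ζ w)) = X.pairing a ζ x * η w := by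
  rw [diagFun, sum_apply]
  simp only [extFun_apply, riesz_apply, QSet.inner_flat]
  conv_rhs => rw [← (stdOrthonormalBasis ℂ (X.H a)).sum_repr' x]
  simp only [map_sum, map_smul, smul_eq_mul, Finset.sum_mul, mul_assoc]

theorem functionalInner_sum_left {ι κ : Type*} [Fintype ι] {Γ : ι → QSet.{u, v}}
    {a : ∀ i, (Γ i).At} (s : Finset κ) (f : κ → Functional Γ a) (ξ : Functional Γ a) :
    functionalInner (∑ k ∈ s, f k) ξ = ∑ k ∈ s, functionalInner (f k) ξ := by
  classical
  induction s using Finset.induction_on with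
  | empty => simp [functionalInner]
  | insert k s hk ih => rw [Finset.sum_insert hk, Finset.sum_insert hk, functionalInner_add_left, ih]

theorem functionalInner_sum_right {ι κ : Type*} [Fintype ι] {Γ : ι → QSet.{u, v}}
    {a : ∀ i, (Γ i).At} (s : Finset κ) (f : κ → Functional Γ a) (ξ : Functional Γ a) :
    functionalInner ξ (∑ k ∈ s, f k) = ∑ k ∈ s, functionalInner ξ (f k) := by
  rw [← functionalInner_conj_symm, functionalInner_sum_left, map_sum]
  simp only [functionalInner_conj_symm]

theorem functionalInner_smul_right {ι : Type*} [Fintype ι] {Γ : ι → QSet.{u, v}}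
    {a : ∀ i, (Γ i).At} (ξ ζ : Functional Γ a) (r : ℂ) :
    functionalInner ξ (r • ζ) = r * functionalInner ξ ζ := by
  rw [← functionalInner_conj_symm, functionalInner_smul_left, map_mul, Complex.conj_conj,
    functionalInner_conj_symm]

/-- Tensoring with evaluation and contracting are mutually adjoint. This turns orthogonality
conditions about the diagonal into conditions on contractions. -/
theorem functionalInner_diagFun (η : Functional Γ β) (ξ : DiagFunctional a a β) :
    functionalInner (diagFun a η) ξ = functionalInner η (contract ξ) := by
  rw [diagFun, contract, functionalInner_sum_left, functionalInner_sum_right]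
  simp only [functionalInner_extFun]

/-- The formula `E_X(x, x_*)` in the context `(x, x_*, …)`. -/
noncomputable abbrev diagFormula (X : QSet.{u, v}) (Γ : Fin n → QSet.{u, v}) :
    Formula (extCtx X (extCtx X.dual Γ)) :=
  .atom₂ (QRel.equality X) 0 1 Fin.zero_ne_one rfl rfl

theorem mem_interp_diagFormula {a' : X.At} {ξ : DiagFunctional a a' β} :
    ξ ∈ (diagFormula X Γ).interp (extAt a (extAt (X.dualAtom a') β)) ↔
      ∀ w : ∀ i, (Γ i).H (β i), ∃ f ∈ BinRel.id X a a', ∀ (x : X.H a)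
        (ζ : X.dual.H (X.dualAtom a')), ξ (extVec x (extVec ζ w)) = X.pairing a' ζ (f x) := by
  refine (Formula.mem_interp_atom₂ (Γ := extCtx X (extCtx X.dual Γ)) Fin.zero_ne_one
    (QRel.equality X)).trans ⟨fun h w => ?_, fun h w => ?_⟩
  · obtain ⟨m, hm, h⟩ := h (extVec 0 (extVec 0 w))
    obtain ⟨f, hf, h'⟩ := (QRel.mem_forms_equality (b := a) (b' := a')).1 hm
    refine ⟨f, hf, fun x ζ => (h _ fun k h0 h1 => ?_).trans (h' x ζ)⟩
    obtain ⟨k, rfl⟩ := Fin.exists_succ_eq.2 h0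
    obtain ⟨k, rfl⟩ := Fin.exists_succ_eq.2 fun h => h1 (congrArg Fin.succ h)
    rfl
  · obtain ⟨x₀, w, rfl⟩ := exists_eq_extVec w
    obtain ⟨ζ₀, w, rfl⟩ := exists_eq_extVec w
    obtain ⟨f, hf, h⟩ := h w
    refine ⟨_, (QRel.mem_forms_equality (b := a) (b' := a')).2 ⟨f, hf, fun _ _ => rfl⟩,
      fun w' hw' => ?_⟩
    obtain ⟨x, w', rfl⟩ := exists_eq_extVec w'
    obtain ⟨ζ, w', rfl⟩ := exists_eq_extVec w'
    obtain rfl : w' = w := funext fun i => hw' i.succ.succ (by simp) (by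
      intro h
      exact Fin.succ_ne_zero i (Fin.succ_injective _ h))
    exact h x ζ

theorem diagFun_mem_interp_diagFormula (η : Functional Γ β) :
    diagFun a η ∈ (diagFormula X Γ).interp (extAt a (extAt (X.dualAtom a) β)) := by
  refine mem_interp_diagFormula.2 fun w => ⟨η w • LinearMap.id, BinRel.mem_id_self.2 ⟨_, rfl⟩,
    fun x ζ => ?_⟩
  rw [diagFun_apply, LinearMap.smul_apply, map_smul, smul_eq_mul, mul_comm, LinearMap.id_apply]

/-- Each slice of `ξ` is `c` times the pairing, and contracting it gives `c` times the dimension of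
the atom; dividing recovers `c`. -/
theorem fixFirst_fixFirst_of_mem {ξ : DiagFunctional a a β}
    (hξ : ξ ∈ (diagFormula X Γ).interp (extAt a (extAt (X.dualAtom a) β))) (x : X.H a)
    (ζ : X.dual.H (X.dualAtom a)) :
    fixFirst ζ (fixFirst x ξ) =
      (X.pairing a ζ x / Module.finrank ℂ (X.H a)) • contract ξ := by
  ext w
  obtain ⟨f, hf, h⟩ := mem_interp_diagFormula.1 hξ w
  obtain ⟨c, rfl⟩ := BinRel.mem_id_self.1 hf
  rw [fixFirst_apply, fixFirst_apply, smul_apply, contract_apply, h]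
  have hd : (Module.finrank ℂ (X.H a) : ℂ) ≠ 0 := Nat.cast_ne_zero.2 Module.finrank_pos.ne'
  simp only [h, LinearMap.smul_apply, LinearMap.id_apply, map_smul, QSet.pairing_flat,
    inner_self_eq_norm_sq_to_K, OrthonormalBasis.norm_eq_one]
  simp
  field_simp

/-- Evaluation is a sum of product functionals and satisfies `E_X`, so modus ponens gives one
direction. For the other, a product functional is its projection onto `E_X`, a multiple of
evaluation tensored with `η`, plus a remainder in `¬E_X`; both parts lie in the Sasaki arrow. -/
theorem Formula.mem_interp_allDiag {φ : Formula (extCtx X (extCtx X.dual Γ))}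
    {η : Functional Γ β} :
    η ∈ (Formula.allDiag X φ).interp β ↔
      ∀ a : X.At, diagFun a η ∈ φ.interp (extAt a (extAt (X.dualAtom a) β)) := by
  have h0 : η ∈ (Formula.allDiag X φ).interp β ↔
      ∀ (a' : X.At) (σ : X.dual.H (X.dualAtom a') →ₗ[ℂ] ℂ) (a : X.At) (ρ : X.H a →ₗ[ℂ] ℂ),
        extFun ρ (extFun σ η) ∈ ((diagFormula X Γ).imp φ).interp
          (extAt a (extAt (X.dualAtom a') β)) := by
    refine Formula.mem_interp_all.trans (forall_congr' fun a' => forall_congr' fun σ => ?_)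
    exact Formula.mem_interp_all
  rw [h0]
  constructor
  · intro h a
    refine Formula.modus_ponens ?_ (diagFun_mem_interp_diagFormula η)
    exact Submodule.sum_mem _ fun k _ => h a _ a _
  · intro h a' σ a ρ
    by_cases haa : a = a'
    · subst haa
      obtain ⟨x, rfl⟩ := exists_eq_riesz ρ
      obtain ⟨ζ, rfl⟩ := exists_eq_riesz σ
      -- The coefficient is the one that makes the difference orthogonal to `E_X`. The conjugate
      -- appears because the inner product is conjugate-linear on the left.
      rw [← add_sub_cancel (conj (X.pairing a ζ x / Module.finrank ℂ (X.H a)) • diagFun a η)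
        (extFun (riesz x) (extFun (riesz ζ) η))]
      refine Formula.add_mem_interp_imp
        (Submodule.smul_mem _ _ (diagFun_mem_interp_diagFormula η))
        (Submodule.smul_mem _ _ (h a)) fun ξ hξ => ?_
      rw [sub_eq_add_neg, ← neg_one_smul ℂ, ← functionalInner_conj_symm,
        functionalInner_add_left, functionalInner_smul_left, functionalInner_smul_left,
        functionalInner_extFun, functionalInner_extFun, fixFirst_fixFirst_of_mem hξ,
        functionalInner_smul_right, functionalInner_diagFun]
      simp
    -- At distinct atoms `E_X` is zero, so every functional lies in `¬E_X`.
    · rw [← zero_add (extFun ρ (extFun σ η))]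
      refine Formula.add_mem_interp_imp (Submodule.zero_mem _) (Submodule.zero_mem _)
        fun ξ hξ => ?_
      have : ξ = 0 := by
        refine ext_extVec fun x w => ?_
        obtain ⟨ζ, w, rfl⟩ := exists_eq_extVec w
        obtain ⟨f, hf, h'⟩ := mem_interp_diagFormula.1 hξ w
        obtain rfl := (BinRel.mem_id_of_ne haa).1 hf
        rw [h' x ζ]
        exact map_zero _
      rw [this]
      simp [functionalInner]

end Diagonal

/-! ### The sentences of a function graph -/

section Sentences

variable {X Y : QSet.{u, v}}

theorem QRel.equality_eq_bend_id : QRel.equality Y = (BinRel.id Y).bend := by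
  have h : ∀ b b', (QRel.equality Y).forms b (Y.dualAtom b') =
      (BinRel.id Y).bend.forms b (Y.dualAtom b') := fun b b' => by
    ext m
    rw [QRel.mem_forms_equality, QRel.mem_forms_bend]
  exact QRel.ext_forms h

/-- The atoms of an empty context. -/
def noAt : ∀ i : Fin 0, (Fin.elim0 i : QSet.{u, v}).At := fun i => i.elim0

/-- The vectors of an empty context. -/
def noVec : ∀ i : Fin 0, (Fin.elim0 i : QSet.{u, v}).H (noAt i) := fun i => i.elim0

theorem eq_noAt (α : ∀ i : Fin 0, (Fin.elim0 i : QSet.{u, v}).At) : α = noAt :=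
  funext fun i => i.elim0

theorem eq_noVec (w : ∀ i : Fin 0, (Fin.elim0 i : QSet.{u, v}).H (noAt i)) : w = noVec :=
  funext fun i => i.elim0

/-- The functional `1` in the empty context. -/
noncomputable def unitFun : Functional (Fin.elim0 : Fin 0 → QSet.{u, v}) noAt :=
  MultilinearMap.constOfIsEmpty ℂ _ 1

theorem unitFun_apply (w : ∀ i : Fin 0, (Fin.elim0 i : QSet.{u, v}).H (noAt i)) :
    unitFun w = 1 := rfl

theorem mem_interp_swapped {F : BinRel X Y} {a : X.At} {b : Y.At}
    {ξ : Functional (extCtx Y.dual (extCtx X Fin.elim0)) (extAt (Y.dualAtom b) (extAt a noAt))} :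
    ξ ∈ (Formula.atom₂ (Γ := extCtx Y.dual (extCtx X Fin.elim0)) F.bend 1 0 (by decide)
        rfl rfl).interp (extAt (Y.dualAtom b) (extAt a noAt)) ↔
      ∃ f ∈ F a b, ∀ (x : X.H a) (η : Y.dual.H (Y.dualAtom b)),
        ξ (extVec η (extVec x noVec)) = Y.pairing b η (f x) := by
  refine (Formula.mem_interp_atom₂_heq _ _ _ _ (α := a) (β := Y.dualAtom b)
    HEq.rfl HEq.rfl).trans ⟨fun h => ?_, fun ⟨f, hf, h⟩ w => ?_⟩
  · obtain ⟨m, hm, h⟩ := h (extVec 0 (extVec 0 noVec))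
    obtain ⟨f, hf, h'⟩ := QRel.mem_forms_bend.1 hm
    refine ⟨f, hf, fun x η => (h _ x η HEq.rfl HEq.rfl fun k h1 h0 => ?_).trans (h' x η)⟩
    fin_cases k
    exacts [absurd rfl h0, absurd rfl h1]
  · refine ⟨_, QRel.mem_forms_bend.2 ⟨f, hf, fun _ _ => rfl⟩, fun w' x η hx hη _ => ?_⟩
    obtain ⟨η', w', rfl⟩ := exists_eq_extVec w'
    obtain ⟨x', w', rfl⟩ := exists_eq_extVec w'
    obtain rfl : x' = x := eq_of_heq hx
    obtain rfl : η' = η := eq_of_heq hη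
    rw [eq_noVec w']
    exact h _ _

/-- A product of bilinear functionals in the variables `0, 2` and `1, 3`. -/
def mulBilinear {E : Fin 4 → Type*} [∀ i, AddCommGroup (E i)] [∀ i, Module ℂ (E i)]
    (p : E 0 →ₗ[ℂ] E 2 →ₗ[ℂ] ℂ) (q : E 1 →ₗ[ℂ] E 3 →ₗ[ℂ] ℂ) : MultilinearMap ℂ E ℂ :=
  MultilinearMap.mk' (fun w => p (w 0) (w 2) * q (w 1) (w 3))
    (fun w i x y => by
      fin_cases i <;> simp [add_mul, mul_add])
    (fun w i c x => by
      fin_cases i <;> simp [mul_assoc, mul_left_comm])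

/-- A bilinear functional as a multilinear one. -/
def ofBilinear {E : Fin 2 → Type*} [∀ i, AddCommGroup (E i)] [∀ i, Module ℂ (E i)]
    (p : E 0 →ₗ[ℂ] E 1 →ₗ[ℂ] ℂ) : MultilinearMap ℂ E ℂ :=
  MultilinearMap.mk' (fun w => p (w 0) (w 1))
    (fun w i x y => by
      fin_cases i <;> simp)
    (fun w i c x => by
      fin_cases i <;> simp)

/-- The sentence holds exactly when `(∀ y_*) ¬G(x, y_*)` is `⊥`. The functional `⟨h, ·⟩` belongs to
that relation if and only if `⟨ζ, ·⟩ ⊗ ⟨h, ·⟩` is orthogonal to every form of `F`, that is, `ζ (f h)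
= 0` for all `ζ` and `f`. -/
theorem interp_totalSentence_eq_top_iff {F : BinRel X Y} :
    (totalSentence F.bend).interp = ⊤ ↔
      ∀ (a : X.At) (h : X.H a), (∀ b, ∀ f ∈ F a b, f h = 0) → h = 0 := by
  refine Formula.interp_all_eq_top_iff.trans (QRel.neg_eq_top_iff.trans ?_)
  have key : ∀ (a : X.At) (h : X.H a) (b : Y.At) (ζ : Y.dual.H (Y.dualAtom b))
      (ξ : Functional (extCtx Y.dual (extCtx X Fin.elim0)) (extAt (Y.dualAtom b) (extAt a noAt))),
      functionalInner (extFun (riesz ζ) (extFun (riesz h) unitFun)) ξ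
        = ξ (extVec ζ (extVec h noVec)) := by
    intro a h b ζ ξ
    rw [functionalInner_extFun, functionalInner_extFun, functionalInner_eq_sum]
    simp only [Finset.univ_unique, Finset.sum_singleton, unitFun_apply, map_one, one_mul,
      fixFirst_apply]
    rw [eq_noVec (fun i => _)]
  have hmem : ∀ (a : X.At) (h : X.H a),
      extFun (riesz h) unitFun ∈
        (Formula.all Y.dual (Formula.neg (Formula.atom₂ (Γ := extCtx Y.dual (extCtx X Fin.elim0))
          F.bend 1 0 (by decide) rfl rfl))).interp (extAt a noAt) ↔
        ∀ b, ∀ f ∈ F a b, f h = 0 := by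
    intro a h
    refine Formula.mem_interp_all.trans ⟨fun H b f hf => ?_, fun H (b : Y.At) ρ ξ hξ => ?_⟩
    · refine Y.eq_zero_of_pairing fun ζ => ?_
      let ξ : Functional (extCtx Y.dual (extCtx X Fin.elim0))
          (extAt (Y.dualAtom b) (extAt a noAt)) :=
        ofBilinear (E := fun i => (extCtx Y.dual (extCtx X Fin.elim0) i).H
          (extAt (Y.dualAtom b) (extAt a noAt) i)) ((Y.pairing b).compl₂ f)
      have h1 := H (Y.dualAtom b) (riesz ζ) ξ
        (mem_interp_swapped.2 ⟨f, hf, fun x η => rfl⟩)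
      rw [← functionalInner_conj_symm, key] at h1
      exact (map_eq_zero _).1 h1
    · obtain ⟨ζ, rfl⟩ := exists_eq_riesz (E := Y.dual.H (Y.dualAtom b)) ρ
      obtain ⟨f, hf, hf'⟩ := (mem_interp_swapped (Y := Y) (F := F) (b := b)).1 hξ
      rw [← functionalInner_conj_symm]
      exact (map_eq_zero _).2 ((key a h b ζ ξ).trans ((hf' h ζ).trans
        ((congrArg (Y.pairing b ζ) (H b f hf)).trans (map_zero _))))
  constructor
  · intro H a h hh
    have h1 := (hmem a h).2 hh
    rw [H] at h1
    have h2 := congrArg (fun ξ => ξ (extVec h noVec)) ((Submodule.mem_bot ℂ).1 h1)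
    have h3 : ⟪h, h⟫_ℂ * 1 = 0 := h2
    rwa [mul_one, inner_self_eq_zero] at h3
  · intro H
    funext α
    obtain ⟨a, α, rfl⟩ := exists_eq_extAt α
    rw [eq_noAt α]
    refine (Submodule.eq_bot_iff _).2 fun η hη => ?_
    -- A functional in a context with one variable is of the form `⟨h, ·⟩`, so testing such
    -- functionals suffices.
    obtain ⟨h, hh⟩ := exists_eq_riesz (E := X.H a)
      (MultilinearMap.toLinearMap (M₁ := fun i => (extCtx X Fin.elim0 i).H (extAt a noAt i))
        η (extVec 0 noVec) 0)
    have h1 : η = extFun (riesz h) unitFun := by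
      refine ext_extVec fun x w => ?_
      rw [eq_noVec w, extFun_apply, unitFun_apply, mul_one, ← hh]
      refine congrArg η ?_
      funext k
      fin_cases k
      rfl
    rw [h1] at hη ⊢
    rw [H a h ((hmem a h).1 hη)]
    refine ext_extVec fun x w => ?_
    rw [extFun_apply, riesz_apply, inner_zero_left, zero_mul]
    rfl

/-- The intersection of `V ⊗ (everything)` and `(everything) ⊗ W` is `V ⊗ W`. Expand in a basis of
`W`. The coefficients need not lie in `V`, but a linear projection onto `V` fixes all slices of `ξ`,
so the coefficients may be replaced by their projections. -/
theorem exists_sum_mul {α β : Type*} {V : Submodule ℂ (α → ℂ)} {W : Submodule ℂ (β → ℂ)}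
    [FiniteDimensional ℂ W] {ξ : α → β → ℂ} (hV : ∀ y, (fun x => ξ x y) ∈ V)
    (hW : ∀ x, ξ x ∈ W) :
    ∃ (n : ℕ) (p : Fin n → α → ℂ) (q : Fin n → β → ℂ), (∀ i, p i ∈ V) ∧ (∀ i, q i ∈ W) ∧
      ∀ x y, ξ x y = ∑ i, p i x * q i y := by
  obtain ⟨P, hP⟩ := V.subtype.exists_leftInverse_of_injective V.ker_subtype
  let e := Module.finBasis ℂ W
  let c : Fin _ → α → ℂ := fun i x => e.repr ⟨ξ x, hW x⟩ i
  have hc : ∀ x y, ξ x y = ∑ i, c i x * (e i : β → ℂ) y := fun x y => by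
    have h1 := congrFun (congrArg Subtype.val (e.sum_repr ⟨ξ x, hW x⟩)) y
    exact h1.symm.trans (by
      simp only [Submodule.coe_sum, Finset.sum_apply, Submodule.coe_smul, Pi.smul_apply,
        smul_eq_mul, c])
  refine ⟨_, fun i => P (c i), fun i => e i, fun i => (P (c i)).2, fun i => (e i).2,
    fun x y => ?_⟩
  have h2 : P (fun x => ξ x y) = ⟨fun x => ξ x y, hV y⟩ :=
    LinearMap.congr_fun hP ⟨fun x => ξ x y, hV y⟩
  have h3 : (fun x => ξ x y) = ∑ i, (e i : β → ℂ) y • c i := by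
    funext x
    simp [hc, mul_comm]
  have h4 : ξ x y = (P (fun x => ξ x y) : α → ℂ) x := by rw [h2]
  rw [h4, h3]
  simp [mul_comm]

/-- Functionals in the context `(x, x_*, y_*, y)`. -/
abbrev QuadFunctional (a a' : X.At) (b' b : Y.At) :=
  DiagFunctional (Γ := extCtx Y.dual (extCtx Y Fin.elim0)) a a'
    (extAt (Y.dualAtom b') (extAt b noAt))

/-- The conjunction `G_*(x_*, y₁) ∧ G(x, y₂_*)`. -/
noncomputable abbrev conjunction (G : QRel ![X, Y.dual]) :
    Formula (extCtx X (extCtx X.dual (extCtx Y.dual (extCtx Y Fin.elim0)))) :=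
  .and (.atom₂ G.conjDual 1 3 (by decide) rfl rfl) (.atom₂ G 0 2 (by decide) rfl rfl)

theorem mem_interp_conjunction {F : BinRel X Y} {a : X.At} {b b' : Y.At}
    {ξ : QuadFunctional a a b' b} :
    ξ ∈ (conjunction F.bend).interp
        (extAt a (extAt (X.dualAtom a) (extAt (Y.dualAtom b') (extAt b noAt)))) ↔
      (∀ x η, ∃ f ∈ F a b, ∀ ζ y, ξ (extVec x (extVec ζ (extVec η (extVec y noVec)))) =
        X.pairing a ζ (LinearMap.adjoint f y)) ∧
      ∀ ζ y, ∃ f ∈ F a b', ∀ x η, ξ (extVec x (extVec ζ (extVec η (extVec y noVec)))) =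
        Y.pairing b' η (f x) := by
  refine and_congr ((Formula.mem_interp_atom₂_heq _ _ _ _ (α := X.dualAtom a) (β := b)
    HEq.rfl HEq.rfl).trans ⟨fun h x η => ?_, fun h w => ?_⟩)
    ((Formula.mem_interp_atom₂_heq _ _ _ _ (α := a) (β := Y.dualAtom b')
    HEq.rfl HEq.rfl).trans ⟨fun h ζ y => ?_, fun h w => ?_⟩)
  · obtain ⟨m, hm, h⟩ := h (extVec x (extVec 0 (extVec η (extVec 0 noVec))))
    obtain ⟨f, hf, h'⟩ := QRel.mem_forms_conjDual_bend.1 hm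
    refine ⟨f, hf, fun ζ y => (h _ ζ y HEq.rfl HEq.rfl fun k h1 h3 => ?_).trans (h' ζ y)⟩
    fin_cases k
    exacts [rfl, absurd rfl h1, rfl, absurd rfl h3]
  · obtain ⟨x, w, rfl⟩ := exists_eq_extVec w
    obtain ⟨ζ, w, rfl⟩ := exists_eq_extVec w
    obtain ⟨η, w, rfl⟩ := exists_eq_extVec w
    obtain ⟨f, hf, h⟩ := h x η
    refine ⟨_, QRel.mem_forms_conjDual_bend.2 ⟨f, hf, fun _ _ => rfl⟩,
      fun w' ζ' y' hζ hy hw' => ?_⟩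
    obtain ⟨x', w', rfl⟩ := exists_eq_extVec w'
    obtain ⟨ζ'', w', rfl⟩ := exists_eq_extVec w'
    obtain ⟨η', w', rfl⟩ := exists_eq_extVec w'
    obtain ⟨y'', w', rfl⟩ := exists_eq_extVec w'
    obtain rfl : ζ'' = ζ' := eq_of_heq hζ
    obtain rfl : y'' = y' := eq_of_heq hy
    obtain rfl : x' = x := hw' 0 (by decide) (by decide)
    obtain rfl : η' = η := hw' 2 (by decide) (by decide)
    rw [eq_noVec w']
    exact h _ _
  · obtain ⟨m, hm, h⟩ := h (extVec 0 (extVec ζ (extVec 0 (extVec y noVec))))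
    obtain ⟨f, hf, h'⟩ := QRel.mem_forms_bend.1 hm
    refine ⟨f, hf, fun x η => (h _ x η HEq.rfl HEq.rfl fun k h0 h2 => ?_).trans (h' x η)⟩
    fin_cases k
    exacts [absurd rfl h0, rfl, absurd rfl h2, rfl]
  · obtain ⟨x, w, rfl⟩ := exists_eq_extVec w
    obtain ⟨ζ, w, rfl⟩ := exists_eq_extVec w
    obtain ⟨η, w, rfl⟩ := exists_eq_extVec w
    obtain ⟨y, w, rfl⟩ := exists_eq_extVec w
    obtain ⟨f, hf, h⟩ := h ζ y
    refine ⟨_, QRel.mem_forms_bend.2 ⟨f, hf, fun _ _ => rfl⟩,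
      fun w' x' η' hx hη hw' => ?_⟩
    obtain ⟨x'', w', rfl⟩ := exists_eq_extVec w'
    obtain ⟨ζ', w', rfl⟩ := exists_eq_extVec w'
    obtain ⟨η'', w', rfl⟩ := exists_eq_extVec w'
    obtain ⟨y', w', rfl⟩ := exists_eq_extVec w'
    obtain rfl : x'' = x' := eq_of_heq hx
    obtain rfl : η'' = η' := eq_of_heq hη
    obtain rfl : ζ' = ζ := hw' 1 (by decide) (by decide)
    obtain rfl : y' = y := hw' 3 (by decide) (by decide)
    rw [eq_noVec w']
    exact h _ _

/-- Contraction over `X_a` is composition through `X_a`, by the expansion of `f† y` in an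
orthonormal basis. -/
theorem pairing_comp_adjoint {a : X.At} {b b' : Y.At} (f : X.H a →ₗ[ℂ] Y.H b)
    (f' : X.H a →ₗ[ℂ] Y.H b') (y : Y.H b) (η : Y.dual.H (Y.dualAtom b')) :
    ∑ k, X.pairing a (X.flat (stdOrthonormalBasis ℂ (X.H a) k)) (LinearMap.adjoint f y) *
        Y.pairing b' η (f' (stdOrthonormalBasis ℂ (X.H a) k)) =
      Y.pairing b' η ((f' ∘ₗ LinearMap.adjoint f) y) := by
  rw [LinearMap.comp_apply]
  conv_rhs => rw [← (stdOrthonormalBasis ℂ (X.H a)).sum_repr' (LinearMap.adjoint f y)]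
  simp only [map_sum, map_smul, smul_eq_mul, QSet.pairing_flat]

/-- The two conjuncts constrain disjoint pairs of variables, so `ξ` is a finite sum of products of a
form of some `f†` with a form of some `f'`. Contraction sends each product to `f' f†`. -/
theorem exists_mem_id_of_conjunction {F : BinRel X Y} {a : X.At} {b b' : Y.At}
    (hF : ∀ f ∈ F a b, ∀ f' ∈ F a b', f' ∘ₗ LinearMap.adjoint f ∈ BinRel.id Y b b')
    {ξ : QuadFunctional a a b' b}
    (hξ : ξ ∈ (conjunction F.bend).interp
        (extAt a (extAt (X.dualAtom a) (extAt (Y.dualAtom b') (extAt b noAt))))) :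
    ∃ T ∈ BinRel.id Y b b', ∀ y η,
      contract ξ (extVec η (extVec y noVec)) = Y.pairing b' η (T y) := by
  obtain ⟨h1, h2⟩ := mem_interp_conjunction.1 hξ
  let V : Submodule ℂ (X.dual.H (X.dualAtom a) × Y.H b → ℂ) := (F.dagger b a).map
    ({ toFun := fun g p => X.pairing a p.1 (g p.2)
       map_add' := fun f g => by funext p; simp
       map_smul' := fun c f => by funext p; simp } :
      (Y.H b →ₗ[ℂ] X.H a) →ₗ[ℂ] X.dual.H (X.dualAtom a) × Y.H b → ℂ)
  let W : Submodule ℂ (X.H a × Y.dual.H (Y.dualAtom b') → ℂ) := (F a b').map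
    ({ toFun := fun g p => Y.pairing b' p.2 (g p.1)
       map_add' := fun f g => by funext p; simp
       map_smul' := fun c f => by funext p; simp } :
      (X.H a →ₗ[ℂ] Y.H b') →ₗ[ℂ] X.H a × Y.dual.H (Y.dualAtom b') → ℂ)
  have hVmem : ∀ q : X.H a × Y.dual.H (Y.dualAtom b'),
      (fun p : X.dual.H (X.dualAtom a) × Y.H b =>
        ξ (extVec q.1 (extVec p.1 (extVec q.2 (extVec p.2 noVec))))) ∈ V := fun q => by
    obtain ⟨f, hf, h⟩ := h1 q.1 q.2
    exact ⟨LinearMap.adjoint f, ⟨f, hf, rfl⟩, by funext p; exact (h p.1 p.2).symm⟩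
  have hWmem : ∀ p : X.dual.H (X.dualAtom a) × Y.H b,
      (fun q : X.H a × Y.dual.H (Y.dualAtom b') =>
        ξ (extVec q.1 (extVec p.1 (extVec q.2 (extVec p.2 noVec))))) ∈ W := fun p => by
    obtain ⟨f, hf, h⟩ := h2 p.1 p.2
    exact ⟨f, hf, by funext q; exact (h q.1 q.2).symm⟩
  obtain ⟨n, p, q, hp, hq, h⟩ := exists_sum_mul hVmem hWmem
  choose g hg hgp using hp
  choose f hf hfp using hg
  choose f' hf' hfq using hq
  refine ⟨∑ i, f' i ∘ₗ LinearMap.adjoint (f i), Submodule.sum_mem _ fun i _ =>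
    hF _ (hf i) _ (hf' i), fun y η => ?_⟩
  rw [contract_apply, LinearMap.sum_apply, map_sum]
  simp only [← pairing_comp_adjoint]
  rw [Finset.sum_comm]
  refine Finset.sum_congr rfl fun k _ => ?_
  refine (h (X.flat (stdOrthonormalBasis ℂ (X.H a) k), y)
    (stdOrthonormalBasis ℂ (X.H a) k, η)).trans (Finset.sum_congr rfl fun i _ => ?_)
  rw [← hgp, ← hfp, ← hfq]
  rfl

/-- A true Sasaki arrow is an inclusion of its antecedent in its consequent. The antecedent is the
orthocomplement of a diagonal quantifier, hence by adjointness it is governed by the contractions of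
the conjunction, and these are built from the operators `f' f†`. -/
theorem interp_univalentSentence_eq_top_iff {F : BinRel X Y} :
    (univalentSentence F.bend).interp = ⊤ ↔ ∀ (a : X.At) (b b' : Y.At), ∀ f ∈ F a b,
      ∀ f' ∈ F a b', f' ∘ₗ LinearMap.adjoint f ∈ BinRel.id Y b b' := by
  refine Formula.interp_all_eq_top_iff.trans (Formula.interp_all_eq_top_iff.trans
    (Formula.interp_imp_eq_top_iff.trans ?_))
  rw [QRel.equality_eq_bend_id]
  constructor
  · intro H a b b' f hf f' hf'
    -- The product of the forms of `f'` and `f†` satisfies the conjunction, and its contraction is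
    -- the form of `f' f†`.
    let ξ : QuadFunctional a a b' b := mulBilinear
      (E := fun i => (extCtx X (extCtx X.dual (extCtx Y.dual (extCtx Y Fin.elim0))) i).H
        (extAt a (extAt (X.dualAtom a) (extAt (Y.dualAtom b') (extAt b noAt))) i))
      ((Y.pairing b').flip ∘ₗ f') ((X.pairing a).compl₂ (LinearMap.adjoint f))
    have hξv : ∀ x ζ η y, ξ (extVec x (extVec ζ (extVec η (extVec y noVec)))) =
        Y.pairing b' η (f' x) * X.pairing a ζ (LinearMap.adjoint f y) := fun _ _ _ _ => rfl
    have hξ : ξ ∈ (conjunction F.bend).interp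
        (extAt a (extAt (X.dualAtom a) (extAt (Y.dualAtom b') (extAt b noAt)))) := by
      refine mem_interp_conjunction.2 ⟨fun x η => ⟨conj (Y.pairing b' η (f' x)) • f,
        Submodule.smul_mem _ _ hf, fun ζ y => ?_⟩, fun ζ y =>
        ⟨X.pairing a ζ (LinearMap.adjoint f y) • f', Submodule.smul_mem _ _ hf', fun x η => ?_⟩⟩
      · rw [hξv, map_smulₛₗ, Complex.conj_conj, LinearMap.smul_apply, map_smul, smul_eq_mul]
      · rw [hξv, LinearMap.smul_apply, map_smul, smul_eq_mul, mul_comm]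
    have hmem := H (extAt (Y.dualAtom b') (extAt b noAt)) (x := contract ξ) (by
      intro η hη
      have h1 := Formula.mem_interp_allDiag.1 hη a ξ hξ
      rw [← functionalInner_conj_symm, functionalInner_diagFun] at h1
      exact (map_eq_zero _).1 h1)
    obtain ⟨T, hT, hT'⟩ := mem_interp_swapped.1 hmem
    have : f' ∘ₗ LinearMap.adjoint f = T := by
      ext y
      refine Y.eq_of_pairing fun η => ?_
      rw [← hT', contract_apply, ← pairing_comp_adjoint]
      simp only [hξv, mul_comm]
    rwa [this]
  · intro H
    -- After taking complements it suffices that every `η` in `¬E_Y` satisfies the diagonal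
    -- quantifier, which means that it is orthogonal to all contractions.
    refine le_of_le_of_eq (QRel.neg_le_neg fun α η hη => ?_) (QRel.neg_neg _)
    obtain ⟨b', α, rfl⟩ := exists_eq_extAt α
    obtain ⟨b, α, rfl⟩ := exists_eq_extAt α
    obtain rfl := eq_noAt α
    refine Formula.mem_interp_allDiag.2 fun a ξ hξ => ?_
    rw [← functionalInner_conj_symm, functionalInner_diagFun, functionalInner_conj_symm]
    obtain ⟨T, hT, hT'⟩ := exists_mem_id_of_conjunction (Y := Y) (F := F) (b' := b') (H a b b') hξ
    exact hη _ (mem_interp_swapped.2 ⟨T, hT, hT'⟩)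

theorem isFunctionGraph_bend_iff {F : BinRel X Y} :
    IsFunctionGraph F.bend ↔
      (∀ (a : X.At) (h : X.H a), (∀ b, ∀ f ∈ F a b, f h = 0) → h = 0) ∧
      ∀ (a : X.At) (b b' : Y.At), ∀ f ∈ F a b, ∀ f' ∈ F a b',
        f' ∘ₗ LinearMap.adjoint f ∈ BinRel.id Y b b' :=
  and_congr interp_totalSentence_eq_top_iff interp_univalentSentence_eq_top_iff

end Sentences

/-! ### Functions between quantum sets -/

namespace BinRel

variable {X Y : QSet.{u, v}} {F : BinRel X Y}

/-- No nonzero vector is in the kernel of all of the operators of `F`. -/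
def IsTotal (F : BinRel X Y) : Prop :=
  ∀ (a : X.At) (h : X.H a), (∀ b, ∀ f ∈ F a b, f h = 0) → h = 0

/-- All of the operators `f' f†` are scalars. -/
def IsUnivalent (F : BinRel X Y) : Prop :=
  ∀ (a : X.At) (b b' : Y.At), ∀ f ∈ F a b, ∀ f' ∈ F a b',
    f' ∘ₗ LinearMap.adjoint f ∈ BinRel.id Y b b'

theorem comp_dagger_le_id_iff : F.comp F.dagger ≤ BinRel.id Y ↔ F.IsUnivalent := by
  constructor
  · intro h a b b' f hf f' hf'
    exact h b b' (Submodule.subset_span ⟨a, f', LinearMap.adjoint f, hf', ⟨f, hf, rfl⟩, rfl⟩)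
  · intro h b b'
    refine Submodule.span_le.2 ?_
    rintro _ ⟨a, f', _, hf', ⟨f, hf, rfl⟩, rfl⟩
    exact h a b b' f hf f' hf'

theorem isTotal_of_id_le (h : BinRel.id X ≤ F.dagger.comp F) : F.IsTotal := by
  intro a x hx
  have key : ∀ t ∈ F.dagger.comp F a a, t x = 0 := fun t ht => by
    induction ht using Submodule.span_induction with
    | mem t ht =>
      obtain ⟨b, s, r, hs, hr, rfl⟩ := ht
      rw [LinearMap.comp_apply, hx b r hr, map_zero]
    | zero => rfl
    | add s t _ _ hs ht => rw [LinearMap.add_apply, hs, ht, add_zero]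
    | smul c t _ ht => rw [LinearMap.smul_apply, ht, smul_zero]
  exact key LinearMap.id (h a a (mem_id_self.2 ⟨1, (one_smul _ _).symm⟩))

theorem comp_mem_of_mem_id {a : X.At} {b b' : Y.At} {f : X.H a →ₗ[ℂ] Y.H b} (hf : f ∈ F a b)
    {t : Y.H b →ₗ[ℂ] Y.H b'} (ht : t ∈ BinRel.id Y b b') : t ∘ₗ f ∈ F a b' := by
  by_cases h : b = b'
  · subst h
    obtain ⟨c, rfl⟩ := mem_id_self.1 ht
    exact Submodule.smul_mem _ c hf
  · obtain rfl := (mem_id_of_ne h).1 ht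
    rw [LinearMap.zero_comp]
    exact Submodule.zero_mem _

/-- The operator `∑ f_k† f_k`, for a finite family of operators in `F`. -/
noncomputable def squareSum {a : X.At} {n : ℕ} (p : Fin n → Σ b, F a b) :
    X.H a →ₗ[ℂ] X.H a :=
  ∑ k, LinearMap.adjoint (p k).2.1 ∘ₗ (p k).2.1

theorem adjoint_squareSum {a : X.At} {n : ℕ} (p : Fin n → Σ b, F a b) :
    LinearMap.adjoint (squareSum p) = squareSum p := by
  simp only [squareSum, map_sum, LinearMap.adjoint_comp, LinearMap.adjoint_adjoint]

/-- In `(g f_k†) f_k` the first factor is a scalar or zero, so each term stays in `F`. -/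
theorem IsUnivalent.comp_squareSum_mem (hU : F.IsUnivalent) {a : X.At} {b : Y.At} {n : ℕ}
    (p : Fin n → Σ b, F a b) {g : X.H a →ₗ[ℂ] Y.H b} (hg : g ∈ F a b) :
    g ∘ₗ squareSum p ∈ F a b := by
  have h : g ∘ₗ squareSum p = ∑ k, (g ∘ₗ LinearMap.adjoint (p k).2.1) ∘ₗ (p k).2.1 := by
    ext x
    simp [squareSum]
  rw [h]
  refine Submodule.sum_mem _ fun k _ => ?_
  exact comp_mem_of_mem_id (p k).2.2 (hU a _ b _ (p k).2.2 g hg)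

/-- A nonzero operator in `F` has a multiple that is a coisometry. -/
theorem IsUnivalent.exists_coisometry (hU : F.IsUnivalent) {a : X.At} {b : Y.At}
    {g : X.H a →ₗ[ℂ] Y.H b} (hg : g ∈ F a b) (h0 : g ≠ 0) :
    ∃ s : ℂ, s ≠ 0 ∧ (s • g) ∘ₗ LinearMap.adjoint (s • g) = LinearMap.id := by
  obtain ⟨c, hc⟩ := mem_id_self.1 (hU a b b g hg g hg)
  -- Univalence gives `g g† = c`. Comparing norms shows that `c` is real and nonnegative, and
  -- nonzero since `g† ≠ 0`; the required scaling is `1 / √c`.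
  have hy : ∀ y : Y.H b, c * (‖y‖ ^ 2 : ℝ) = (‖LinearMap.adjoint g y‖ ^ 2 : ℝ) := fun y => by
    have h1 : ⟪y, (g ∘ₗ LinearMap.adjoint g) y⟫_ℂ = ⟪LinearMap.adjoint g y, LinearMap.adjoint g y⟫_ℂ := by
      rw [LinearMap.adjoint_inner_left, LinearMap.comp_apply]
    rw [hc, LinearMap.smul_apply, inner_smul_right, LinearMap.id_apply,
      inner_self_eq_norm_sq_to_K, inner_self_eq_norm_sq_to_K] at h1
    simpa using h1
  obtain ⟨y, hy0⟩ := exists_ne (0 : Y.H b)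
  have hyn : ‖y‖ ≠ 0 := norm_ne_zero_iff.2 hy0
  set r : ℝ := ‖LinearMap.adjoint g y‖ ^ 2 / ‖y‖ ^ 2 with hr
  have hcr : c = r := by
    have := hy y
    rw [hr, Complex.ofReal_div, eq_div_iff (by simpa using hyn)]
    exact this
  have hr0 : r ≠ 0 := by
    intro hr0
    refine h0 ?_
    rw [← LinearMap.adjoint_adjoint g, map_eq_zero_iff _ (LinearEquiv.injective _)]
    ext z
    have := hy z
    rw [hcr, hr0] at this
    simpa using this.symm
  have hrpos : 0 < r := lt_of_le_of_ne (by positivity) hr0.symm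
  refine ⟨((√r)⁻¹ : ℝ), by simpa using (Real.sqrt_pos.2 hrpos).ne', ?_⟩
  rw [map_smulₛₗ, LinearMap.smul_comp, LinearMap.comp_smul, hc, hcr, smul_smul, smul_smul,
    Complex.conj_ofReal, ← Complex.ofReal_mul, ← Complex.ofReal_mul]
  have : (√r)⁻¹ * (√r)⁻¹ * r = 1 := by
    rw [← mul_inv, Real.mul_self_sqrt hrpos.le, inv_mul_cancel₀ hr0]
  rw [this, Complex.ofReal_one, one_smul]

/-- Induction on the dimension of the kernel of the projection `P = ∑ f_k† f_k`. If `P h = 0` with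
`h ≠ 0`, totality provides `g` in `F` with `g h ≠ 0`. The operator `g - g P` is still in `F`,
vanishes on the range of `P` and not at `h`. Rescaled to a coisometry `f`, it adds to `P` the
orthogonal projection `f† f`, which strictly shrinks the kernel. -/
theorem exists_squareSum_eq_id_of_idempotent (hT : F.IsTotal) (hU : F.IsUnivalent) {a : X.At}
    (m : ℕ) : ∀ {n : ℕ} (p : Fin n → Σ b, F a b), squareSum p ∘ₗ squareSum p = squareSum p →
      Module.finrank ℂ (LinearMap.ker (squareSum p)) = m →
      ∃ (n : ℕ) (q : Fin n → Σ b, F a b), squareSum q = LinearMap.id := by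
  induction m using Nat.strong_induction_on with
  | _ m ih =>
    intro n p hp hm
    by_cases hker : ∀ h, squareSum p h = 0 → h = 0
    · refine ⟨n, p, ?_⟩
      ext x
      have h1 : squareSum p (squareSum p x - x) = 0 := by
        rw [map_sub, ← LinearMap.comp_apply, hp, sub_self]
      exact sub_eq_zero.1 (hker _ h1)
    · push Not at hker
      obtain ⟨h, hPh, h0⟩ := hker
      have : ∃ b, ∃ g ∈ F a b, g h ≠ 0 := by
        by_contra! hcon
        exact h0 (hT a h hcon)
      obtain ⟨b, g, hg, hgh⟩ := this
      have hg1 : g - g ∘ₗ squareSum p ∈ F a b :=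
        Submodule.sub_mem _ hg (hU.comp_squareSum_mem p hg)
      have hg1h : (g - g ∘ₗ squareSum p) h ≠ 0 := by simpa [hPh] using hgh
      obtain ⟨s, hs0, hs⟩ := hU.exists_coisometry hg1 fun h' => hg1h (by rw [h']; rfl)
      set f := s • (g - g ∘ₗ squareSum p) with hf
      have hfF : f ∈ F a b := Submodule.smul_mem _ _ hg1
      have hfP : f ∘ₗ squareSum p = 0 := by
        rw [hf, LinearMap.smul_comp, LinearMap.sub_comp, LinearMap.comp_assoc, hp, sub_self,
          smul_zero]
      have hPf : squareSum p ∘ₗ LinearMap.adjoint f = 0 := by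
        have := congrArg LinearMap.adjoint hfP
        rwa [LinearMap.adjoint_comp, adjoint_squareSum, map_zero] at this
      have hfh : f h ≠ 0 := by
        rw [hf, LinearMap.smul_apply]
        exact smul_ne_zero hs0 hg1h
      let q : Fin (n + 1) → Σ b, F a b := Fin.cons ⟨b, f, hfF⟩ p
      have hq : squareSum q = LinearMap.adjoint f ∘ₗ f + squareSum p := by
        rw [squareSum, Fin.sum_univ_succ]
        rfl
      refine ih _ ?_ q ?_ rfl
      · rw [← hm, hq]
        refine Submodule.finrank_lt_finrank_of_lt (lt_of_le_of_ne (fun x hx => ?_) fun heq => ?_)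
        -- Applying `P` kills the new summand, as `P f† = 0`, so the new kernel lies in the old one;
        -- the vector `h` shows that it is smaller.
        · rw [LinearMap.mem_ker] at hx ⊢
          have h1 := congrArg (squareSum p) hx
          rw [LinearMap.add_apply, map_add, map_zero, LinearMap.comp_apply,
            ← LinearMap.comp_apply (squareSum p), hPf, LinearMap.zero_apply, zero_add,
            ← LinearMap.comp_apply, hp] at h1
          exact h1
        · have h1 : h ∈ LinearMap.ker (squareSum p) := hPh
          rw [← heq, LinearMap.mem_ker, LinearMap.add_apply, hPh, add_zero] at h1
          have h2 := congrArg f h1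
          rw [LinearMap.comp_apply, ← LinearMap.comp_apply f, hs, map_zero] at h2
          exact hfh h2
      · have h1 : ∀ z, f (squareSum p z) = 0 := LinearMap.congr_fun hfP
        have h2 : ∀ z, squareSum p (LinearMap.adjoint f z) = 0 := LinearMap.congr_fun hPf
        have h3 : ∀ z, f (LinearMap.adjoint f z) = z := LinearMap.congr_fun hs
        have h4 : ∀ z, squareSum p (squareSum p z) = squareSum p z := LinearMap.congr_fun hp
        ext x
        simp only [hq, LinearMap.comp_apply, LinearMap.add_apply, map_add, h1, h2, h3, h4,
          map_zero, add_zero, zero_add]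

theorem exists_squareSum_eq_id (hT : F.IsTotal) (hU : F.IsUnivalent) (a : X.At) :
    ∃ (n : ℕ) (p : Fin n → Σ b, F a b), squareSum p = LinearMap.id :=
  exists_squareSum_eq_id_of_idempotent hT hU _ (n := 0) Fin.elim0 (by simp [squareSum]) rfl

theorem isFunction_iff : F.IsFunction ↔ F.IsTotal ∧ F.IsUnivalent := by
  constructor
  · intro h
    exact ⟨isTotal_of_id_le h.1, comp_dagger_le_id_iff.1 h.2⟩
  · rintro ⟨hT, hU⟩
    refine ⟨fun a a' t ht => ?_, comp_dagger_le_id_iff.2 hU⟩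
    by_cases h : a = a'
    · subst h
      obtain ⟨c, rfl⟩ := mem_id_self.1 ht
      obtain ⟨n, p, hp⟩ := exists_squareSum_eq_id hT hU a
      rw [← hp]
      refine Submodule.smul_mem _ _ (Submodule.sum_mem _ fun k _ => Submodule.subset_span ?_)
      exact ⟨(p k).1, _, _, ⟨_, (p k).2.2, rfl⟩, (p k).2.2, rfl⟩
    · obtain rfl := (mem_id_of_ne h).1 ht
      exact Submodule.zero_mem _

theorem isFunctionGraph_bend : IsFunctionGraph F.bend ↔ F.IsFunction :=
  isFunctionGraph_bend_iff.trans isFunction_iff.symm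

theorem inner_eq_sum {a : X.At} {n : ℕ} {p : Fin n → Σ b, F a b}
    (hp : squareSum p = LinearMap.id) (x x' : X.H a) :
    ⟪x, x'⟫_ℂ = ∑ k, ⟪(p k).2.1 x, (p k).2.1 x'⟫_ℂ := by
  conv_lhs => rw [← LinearMap.id_apply (R := ℂ) x', ← hp]
  rw [squareSum, LinearMap.sum_apply, inner_sum]
  refine Finset.sum_congr rfl fun k _ => ?_
  rw [LinearMap.comp_apply, LinearMap.adjoint_inner_right]

theorem norm_sq_eq_sum {a : X.At} {n : ℕ} {p : Fin n → Σ b, F a b}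
    (hp : squareSum p = LinearMap.id) (x : X.H a) :
    ‖x‖ ^ 2 = ∑ k, ‖(p k).2.1 x‖ ^ 2 := by
  have := inner_eq_sum hp x x
  simp only [inner_self_eq_norm_sq_to_K] at this
  exact_mod_cast this

theorem eq_of_forall_apply_eq (hT : F.IsTotal) {a : X.At} {x x' : X.H a}
    (h : ∀ b, ∀ f ∈ F a b, f x = f x') : x = x' :=
  sub_eq_zero.1 (hT a _ fun b f hf => by rw [map_sub, h b f hf, sub_self])

theorem apply_comm_of_mem_id {b b' : Y.At} {t : Y.H b →ₗ[ℂ] Y.H b'} (ht : t ∈ BinRel.id Y b b')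
    (c : LInf Y) (y : Y.H b) : c b' (t y) = t (c b y) := by
  by_cases h : b = b'
  · subst h
    obtain ⟨r, rfl⟩ := mem_id_self.1 ht
    simp
  · obtain rfl := (mem_id_of_ne h).1 ht
    simp

end BinRel

/-! ### The homomorphism of a function -/

section DualHom

variable {X Y : QSet.{u, v}} {F : BinRel X Y}

/-- With `1 = ∑ f_k† f_k`, take `t = ∑ f_k† c f_k`. Each `f f_k†` is scalar or zero and so passes
through `c`, which gives `f t = c f`. -/
theorem exists_intertwined (hT : F.IsTotal) (hU : F.IsUnivalent) (c : LInf Y) (a : X.At) :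
    ∃ t : X.H a →L[ℂ] X.H a, (∀ b, ∀ f ∈ F a b, ∀ x, c b (f x) = f (t x)) ∧ ‖t‖ ≤ ‖c‖ := by
  obtain ⟨n, p, hp⟩ := BinRel.exists_squareSum_eq_id hT hU a
  let t : X.H a →ₗ[ℂ] X.H a :=
    ∑ k, LinearMap.adjoint (p k).2.1 ∘ₗ (c (p k).1).toLinearMap ∘ₗ (p k).2.1
  have ht : ∀ b, ∀ f ∈ F a b, ∀ x, c b (f x) = f (t x) := fun b f hf x => by
    conv_lhs => rw [← LinearMap.id_apply (R := ℂ) x, ← hp]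
    simp only [BinRel.squareSum, t, LinearMap.sum_apply, map_sum, LinearMap.comp_apply]
    refine Finset.sum_congr rfl fun k _ => ?_
    exact BinRel.apply_comm_of_mem_id (hU a _ b _ (p k).2.2 f hf) c _
  refine ⟨LinearMap.toContinuousLinearMap t, ht, ?_⟩
  refine ContinuousLinearMap.opNorm_le_bound _ (norm_nonneg _) fun x => ?_
  -- The resolution gives `‖u‖² = ∑ ‖f_k u‖²`, and `f_k t x = c f_k x` allows a comparison term by
  -- term.
  refine (sq_le_sq₀ (norm_nonneg _) (by positivity)).1 ?_
  rw [mul_pow, BinRel.norm_sq_eq_sum hp x, BinRel.norm_sq_eq_sum hp, Finset.mul_sum]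
  refine Finset.sum_le_sum fun k _ => ?_
  rw [LinearMap.coe_toContinuousLinearMap', ← ht _ _ (p k).2.2, ← mul_pow]
  gcongr
  exact (ContinuousLinearMap.le_opNorm _ _).trans (by
    gcongr
    exact lp.norm_apply_le_norm ENNReal.top_ne_zero c _)

/-- By totality it suffices to apply each `g` in `F`, and `g f†` commutes with `c` because it is
scalar or zero. This is what makes the homomorphism preserve the star. -/
theorem apply_adjoint_of_intertwined (hT : F.IsTotal) (hU : F.IsUnivalent) {c : LInf Y}
    {a : X.At} {t : X.H a →L[ℂ] X.H a} (ht : ∀ b, ∀ f ∈ F a b, ∀ x, c b (f x) = f (t x))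
    {b : Y.At} {f : X.H a →ₗ[ℂ] Y.H b} (hf : f ∈ F a b) (y : Y.H b) :
    t (LinearMap.adjoint f y) = LinearMap.adjoint f (c b y) := by
  refine BinRel.eq_of_forall_apply_eq hT fun b' g hg => ?_
  rw [← ht b' g hg]
  exact BinRel.apply_comm_of_mem_id (hU a b b' f hf g hg) c y

theorem exists_isDualHom (hT : F.IsTotal) (hU : F.IsUnivalent) :
    ∃ φ : LInf Y →⋆ₐ[ℂ] LInf X, IsDualHom F φ := by
  choose t ht hnorm using exists_intertwined hT hU
  -- Totality makes the intertwined operator unique, so every algebraic law reduces to checking that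
  -- the expected operator intertwines.
  have huniq : ∀ (c : LInf Y) (a : X.At) (s : X.H a →L[ℂ] X.H a),
      (∀ b, ∀ f ∈ F a b, ∀ x, c b (f x) = f (s x)) → t c a = s := fun c a s hs => by
    ext x
    refine BinRel.eq_of_forall_apply_eq hT fun b f hf => ?_
    rw [← hs b f hf, ← ht c a b f hf]
  have hmem : ∀ c : LInf Y, Memℓp (t c) ∞ := fun c => memℓp_infty ⟨‖c‖, by
    rintro _ ⟨a, rfl⟩
    exact hnorm c a⟩
  refine ⟨{ toFun := fun c => ⟨t c, hmem c⟩
            map_one' := ?_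
            map_mul' := ?_
            map_zero' := ?_
            map_add' := ?_
            commutes' := ?_
            map_star' := ?_ }, fun a b f hf c x => ht c a b f hf x⟩
  · refine lp.ext (funext fun a => huniq _ _ _ fun b f hf x => ?_)
    simp
  · intro c d
    refine lp.ext (funext fun a => huniq _ _ _ fun b f hf x => ?_)
    change c b (d b (f x)) = f (t c a (t d a x))
    rw [ht d a b f hf, ht c a b f hf]
  · refine lp.ext (funext fun a => huniq _ _ _ fun b f hf x => ?_)
    simp
  · intro c d
    refine lp.ext (funext fun a => huniq _ _ _ fun b f hf x => ?_)
    change c b (f x) + d b (f x) = f (t c a x + t d a x)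
    rw [map_add, ht d a b f hf, ht c a b f hf]
  · intro r
    refine lp.ext (funext fun a => huniq _ _ _ fun b f hf x => ?_)
    rw [Algebra.algebraMap_eq_smul_one, Algebra.algebraMap_eq_smul_one]
    change r • f x = f (r • x)
    rw [map_smul]
  · intro c
    refine lp.ext (funext fun a => huniq _ _ _ fun b f hf x => ?_)
    change (ContinuousLinearMap.adjoint (c b)) (f x) = f (ContinuousLinearMap.adjoint (t c a) x)
    refine ext_inner_right ℂ fun y => ?_
    rw [ContinuousLinearMap.adjoint_inner_left, ← LinearMap.adjoint_inner_right,
      ← LinearMap.adjoint_inner_right, ContinuousLinearMap.adjoint_inner_left,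
      apply_adjoint_of_intertwined hT hU (ht c a) hf]

theorem IsDualHom.eq (hT : F.IsTotal) {φ ψ : LInf Y →⋆ₐ[ℂ] LInf X} (hφ : IsDualHom F φ)
    (hψ : IsDualHom F ψ) : φ = ψ := by
  ext1 c
  refine lp.ext (funext fun a => ?_)
  ext x
  refine BinRel.eq_of_forall_apply_eq hT fun b f hf => ?_
  rw [← hφ a b f hf, ← hψ a b f hf]

end DualHom

/-! ### Normality -/

section Normal

open scoped ComplexOrder Topology
open Filter

variable {X Y : QSet.{u, v}} {F : BinRel X Y}

theorem ContinuousLinearMap.le_iff_inner_le {E : Type*} [NormedAddCommGroup E]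
    [InnerProductSpace ℂ E] [CompleteSpace E] {s t : E →L[ℂ] E} :
    s ≤ t ↔ ∀ x, ⟪s x, x⟫_ℂ ≤ ⟪t x, x⟫_ℂ := by
  rw [ContinuousLinearMap.le_def, ContinuousLinearMap.isPositive_iff_complex]
  refine forall_congr' fun x => ?_
  rw [sub_apply, inner_sub_left, ← sub_nonneg (a := ⟪t x, x⟫_ℂ), Complex.nonneg_iff, and_comm]
  refine and_congr_right fun _ => ?_
  rw [Complex.ext_iff]
  simp

theorem LInf.le_iff {c d : LInf X} : c ≤ d ↔ ∀ a x, ⟪c a x, x⟫_ℂ ≤ ⟪d a x, x⟫_ℂ :=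
  forall_congr' fun _ => ContinuousLinearMap.le_iff_inner_le

/-- Along an ultrafilter, a bounded directed set converges at each atom to an upper bound of the
component of its supremum. -/
theorem exists_tendsto_atom {S : Set (LInf Y)} {s : LInf Y} (hne : S.Nonempty)
    (hs : IsLUB S s) (U : Ultrafilter S) (hU : (U : Filter S) ≤ atTop) (b : Y.At) :
    ∃ t : Y.H b →L[ℂ] Y.H b, Tendsto (fun c : S => (c : LInf Y) b) U (𝓝 t) ∧
      ∀ y, ⟪s b y, y⟫_ℂ ≤ ⟪t y, y⟫_ℂ := by
  classical
  obtain ⟨c₀, hc₀⟩ := hne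
  -- Beyond `c₀` the components lie between those of `c₀` and `s`, hence in a ball, which is compact
  -- in finite dimension.
  have hbound : ∀ᶠ c : S in U, (c : LInf Y) b ∈
      Metric.closedBall (0 : Y.H b →L[ℂ] Y.H b) (‖s b - c₀ b‖ + ‖c₀ b‖) := by
    refine hU ((eventually_ge_atTop (⟨c₀, hc₀⟩ : S)).mono fun c hc => ?_)
    have h1 : c₀ b ≤ (c : LInf Y) b := hc b
    have h2 : (c : LInf Y) b ≤ s b := hs.1 c.2 b
    have h3 : ‖(c : LInf Y) b - c₀ b‖ ≤ ‖s b - c₀ b‖ :=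
      CStarAlgebra.norm_le_norm_of_nonneg_of_le (sub_nonneg.2 h1) (sub_le_sub_right h2 _)
    rw [mem_closedBall_zero_iff]
    calc ‖(c : LInf Y) b‖ = ‖((c : LInf Y) b - c₀ b) + c₀ b‖ := by rw [sub_add_cancel]
      _ ≤ _ := (norm_add_le _ _).trans (by gcongr)
  have : ProperSpace (Y.H b →L[ℂ] Y.H b) := FiniteDimensional.proper ℂ _
  obtain ⟨t, -, ht⟩ := (isCompact_closedBall (0 : Y.H b →L[ℂ] Y.H b)
    (‖s b - c₀ b‖ + ‖c₀ b‖)).ultrafilter_le_nhds (U.map fun c : S => (c : LInf Y) b)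
    (le_principal_iff.2 hbound)
  have ht' : Tendsto (fun c : S => (c : LInf Y) b) U (𝓝 t) := ht
  refine ⟨t, ht', ?_⟩
  have hinner : ∀ y, Tendsto (fun c : S => ⟪(c : LInf Y) b y, y⟫_ℂ) U (𝓝 ⟪t y, y⟫_ℂ) :=
    fun y => by
      have h1 : Continuous fun r : Y.H b →L[ℂ] Y.H b => ⟪r y, y⟫_ℂ := by fun_prop
      exact (h1.tendsto t).comp ht'
  -- Replacing the component of `s` at `b` by the limit still gives an upper bound, so the least
  -- upper bound lies below it.
  have hle : s ≤ s + lp.single ∞ b (t - s b) := by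
    refine hs.2 fun d hd => LInf.le_iff.2 fun b' y => ?_
    by_cases hb : b' = b
    · subst hb
      have h1 : (s + lp.single ∞ b' (t - s b') : LInf Y) b' = t := by
        rw [lp.coeFn_add, Pi.add_apply, lp.single_apply_self, add_sub_cancel]
      rw [h1]
      refine ge_of_tendsto (hinner y) (hU ?_)
      exact (eventually_ge_atTop (⟨d, hd⟩ : S)).mono fun c hc => LInf.le_iff.1 hc b' y
    · have h1 : (s + lp.single ∞ b (t - s b) : LInf Y) b' = s b' := by
        rw [lp.coeFn_add, Pi.add_apply, lp.single_apply_ne _ _ _ hb, add_zero]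
      rw [h1]
      exact LInf.le_iff.1 (hs.1 hd) b' y
  intro y
  have h1 := LInf.le_iff.1 hle b y
  rwa [lp.coeFn_add, Pi.add_apply, lp.single_apply_self, add_sub_cancel] at h1

/-- `⟨φ(c) x, x⟩` equals `∑ ⟨c f_k x, f_k x⟩`, which involves finitely many atoms. A single
ultrafilter makes `c` converge at all of them, so a bound on the images of `S` passes to the limit,
which dominates the value at `s`. -/
theorem IsDualHom.isNormalHom (hT : F.IsTotal) (hU : F.IsUnivalent)
    {φ : LInf Y →⋆ₐ[ℂ] LInf X} (hφ : IsDualHom F φ) : IsNormalHom φ := by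
  intro S s hne hdir _ hs
  have hinner : ∀ a, ∃ (n : ℕ) (p : Fin n → Σ b, F a b), ∀ (c : LInf Y) (x : X.H a),
      ⟪φ c a x, x⟫_ℂ = ∑ k, ⟪c (p k).1 ((p k).2.1 x), (p k).2.1 x⟫_ℂ := fun a => by
    obtain ⟨n, p, hp⟩ := BinRel.exists_squareSum_eq_id hT hU a
    refine ⟨n, p, fun c x => ?_⟩
    rw [BinRel.inner_eq_sum hp]
    refine Finset.sum_congr rfl fun k _ => ?_
    rw [← hφ a _ _ (p k).2.2]
  constructor
  · rintro _ ⟨c, hc, rfl⟩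
    refine LInf.le_iff.2 fun a x => ?_
    obtain ⟨n, p, hp⟩ := hinner a
    rw [hp, hp]
    exact Finset.sum_le_sum fun k _ => LInf.le_iff.1 (hs.1 hc) _ _
  · intro d hd
    refine LInf.le_iff.2 fun a x => ?_
    obtain ⟨n, p, hp⟩ := hinner a
    have : Nonempty S := hne.to_subtype
    have : IsDirectedOrder S := hdir.isDirectedOrder
    let U : Ultrafilter S := Ultrafilter.of atTop
    choose t ht hst using exists_tendsto_atom hne hs U (Ultrafilter.of_le _)
    have h1 : Tendsto (fun c : S => ⟪φ c a x, x⟫_ℂ) U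
        (𝓝 (∑ k, ⟪t (p k).1 ((p k).2.1 x), (p k).2.1 x⟫_ℂ)) := by
      simp only [hp]
      refine tendsto_finsetSum _ fun k _ => ?_
      have h2 : Continuous fun r : Y.H (p k).1 →L[ℂ] Y.H (p k).1 =>
        ⟪r ((p k).2.1 x), (p k).2.1 x⟫_ℂ := by fun_prop
      exact (h2.tendsto _).comp (ht (p k).1)
    calc ⟪φ s a x, x⟫_ℂ ≤ ∑ k, ⟪t (p k).1 ((p k).2.1 x), (p k).2.1 x⟫_ℂ := by
          rw [hp]
          exact Finset.sum_le_sum fun k _ => hst _ _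
      _ ≤ ⟪d a x, x⟫_ℂ := le_of_tendsto h1
          (Eventually.of_forall fun c => LInf.le_iff.1 (hd ⟨c, c.2, rfl⟩) a x)

end Normal

/-! ### Intertwiners -/

section Intertwiners

variable {X Y : QSet.{u, v}} {φ : LInf Y →⋆ₐ[ℂ] LInf X}

/-- Take adjoints in the intertwining relation for `star c`. -/
theorem apply_adjoint_of_mem_intertwiners {a : X.At} {b : Y.At} {f : X.H a →ₗ[ℂ] Y.H b}
    (hf : f ∈ intertwiners φ a b) (c : LInf Y) (y : Y.H b) :
    φ c a (LinearMap.adjoint f y) = LinearMap.adjoint f (c b y) := by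
  refine ext_inner_right ℂ fun x => ?_
  have h1 : φ (star c) a = ContinuousLinearMap.adjoint (φ c a) := by
    rw [map_star, lp.coeFn_star]
    rfl
  have h2 : (star c : LInf Y) b = ContinuousLinearMap.adjoint (c b) := by
    rw [lp.coeFn_star]
    rfl
  rw [LinearMap.adjoint_inner_left, ← ContinuousLinearMap.adjoint_inner_right, ← h1,
    LinearMap.adjoint_inner_left, ← hf (star c) x, h2, ContinuousLinearMap.adjoint_inner_right]

/-- Commuting with the rank-one operators `|y⟩⟨z|`, evaluated at `z`, gives `⟨z, z⟩ t y = ⟨z, t z⟩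
y`. Between distinct atoms, the unit of the target block fixes `t y` and kills `y`. -/
theorem mem_id_of_commute {b b' : Y.At} {t : Y.H b →ₗ[ℂ] Y.H b'}
    (h : ∀ (c : LInf Y) (y : Y.H b), c b' (t y) = t (c b y)) : t ∈ BinRel.id Y b b' := by
  classical
  by_cases hb : b = b'
  · subst hb
    obtain ⟨z, hz⟩ := exists_ne (0 : Y.H b)
    refine BinRel.mem_id_self.2 ⟨⟪z, t z⟫_ℂ / ⟪z, z⟫_ℂ, ?_⟩
    ext y
    have h1 := h (lp.single ∞ b (InnerProductSpace.rankOne ℂ y z)) z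
    rw [lp.single_apply_self, InnerProductSpace.rankOne_apply, InnerProductSpace.rankOne_apply,
      map_smul] at h1
    rw [LinearMap.smul_apply, LinearMap.id_apply, div_eq_inv_mul, mul_smul, h1,
      inv_smul_smul₀ (inner_self_ne_zero.2 hz)]
  · refine (BinRel.mem_id_of_ne hb).2 ?_
    ext y
    have h1 := h (lp.single ∞ b' 1) y
    rwa [lp.single_apply_self, lp.single_apply_ne _ _ _ hb, zero_apply,
      map_zero] at h1

theorem isUnivalent_intertwiners : (intertwiners φ).IsUnivalent := by
  intro a b b' f hf f' hf'
  refine mem_id_of_commute fun c y => ?_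
  rw [LinearMap.comp_apply, LinearMap.comp_apply, hf' c, apply_adjoint_of_mem_intertwiners hf]

/-- An intertwiner `g` equals `∑ (g f_k†) f_k`. Since intertwiners are univalent, each `g f_k†` is
in `I_Y`, so `g` already lies in `F`. -/
theorem IsDualHom.eq_intertwiners {F : BinRel X Y} (hT : F.IsTotal) (hU : F.IsUnivalent)
    (hφ : IsDualHom F φ) : F = intertwiners φ := by
  have hle : F ≤ intertwiners φ := fun a b f hf => hφ a b f hf
  refine le_antisymm hle fun a b g hg => ?_
  obtain ⟨n, p, hp⟩ := BinRel.exists_squareSum_eq_id hT hU a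
  have h : g = ∑ k, (g ∘ₗ LinearMap.adjoint (p k).2.1) ∘ₗ (p k).2.1 := by
    ext x
    conv_lhs => rw [← LinearMap.id_apply (R := ℂ) x, ← hp]
    simp [BinRel.squareSum]
  rw [h]
  refine Submodule.sum_mem _ fun k _ => BinRel.comp_mem_of_mem_id (p k).2.2 ?_
  exact isUnivalent_intertwiners a _ b _ (hle a _ (p k).2.2) g hg

open Classical in
/-- The projection onto finitely many atoms. -/
noncomputable def atomProj (s : Finset Y.At) : LInf Y := ∑ b ∈ s, lp.single ∞ b 1

open Classical in
theorem atomProj_apply (s : Finset Y.At) (b : Y.At) :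
    atomProj s b = if b ∈ s then 1 else 0 := by
  rw [atomProj, lp.coeFn_sum, Finset.sum_apply]
  exact Finset.sum_pi_single b (fun _ => 1) s

theorem atomProj_mul_self (s : Finset Y.At) : atomProj s * atomProj s = atomProj s := by
  refine lp.ext (funext fun b => ?_)
  rw [lp.infty_coeFn_mul, Pi.mul_apply, atomProj_apply]
  split_ifs <;> simp

theorem star_atomProj (s : Finset Y.At) : star (atomProj s) = atomProj s := by
  refine lp.ext (funext fun b => ?_)
  rw [lp.coeFn_star, Pi.star_apply, atomProj_apply]
  split_ifs <;> simp

open scoped ComplexOrder in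
theorem atomProj_mono {s t : Finset Y.At} (h : s ⊆ t) : atomProj s ≤ atomProj t := by
  refine LInf.le_iff.2 fun b y => ?_
  rw [atomProj_apply, atomProj_apply]
  split_ifs with h1 h2 h2
  · exact le_rfl
  · exact absurd (h h1) h2
  · simp
  · exact le_rfl

open scoped ComplexOrder in
theorem isLUB_atomProj : IsLUB (Set.range (atomProj (Y := Y))) 1 := by
  constructor
  · rintro _ ⟨s, rfl⟩
    refine LInf.le_iff.2 fun b y => ?_
    rw [atomProj_apply, lp.infty_coeFn_one]
    split_ifs
    · exact le_rfl
    · simp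
  · intro c hc
    refine LInf.le_iff.2 fun b y => ?_
    -- The order is atomwise, so the projection onto the single atom `b` settles the component
    -- there.
    have := LInf.le_iff.1 (hc ⟨{b}, rfl⟩) b y
    rw [atomProj_apply, if_pos (Finset.mem_singleton_self b)] at this
    rwa [lp.infty_coeFn_one]

open Classical in
theorem LInf.mul_single (c : LInf Y) (b : Y.At) (r : Y.H b →L[ℂ] Y.H b) :
    c * lp.single ∞ b r = lp.single ∞ b (c b * r) := by
  refine lp.ext (funext fun b' => ?_)
  rw [lp.infty_coeFn_mul, Pi.mul_apply]
  by_cases h : b' = b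
  · subst h
    rw [lp.single_apply_self, lp.single_apply_self]
  · rw [lp.single_apply_ne _ _ _ h, lp.single_apply_ne _ _ _ h, mul_zero]

open Classical in
theorem LInf.star_single (b : Y.At) (r : Y.H b →L[ℂ] Y.H b) :
    star (lp.single ∞ b r : LInf Y) = lp.single ∞ b (star r) := by
  refine lp.ext (funext fun b' => ?_)
  rw [lp.coeFn_star, Pi.star_apply]
  by_cases h : b' = b
  · subst h
    rw [lp.single_apply_self, lp.single_apply_self]
  · rw [lp.single_apply_ne _ _ _ h, lp.single_apply_ne _ _ _ h, star_zero]

theorem inner_apply_star (c : LInf X) (a : X.At) (x x' : X.H a) :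
    ⟪(star c : LInf X) a x, x'⟫_ℂ = ⟪x, c a x'⟫_ℂ := by
  rw [lp.coeFn_star, Pi.star_apply]
  exact ContinuousLinearMap.adjoint_inner_left _ _ _

open Classical in
/-- The adjoint of `y ↦ φ(|y⟩⟨z|) x` is an intertwiner. -/
theorem exists_intertwiner (a : X.At) (b : Y.At) (x : X.H a) (z : Y.H b) :
    ∃ f ∈ intertwiners φ a b, ∀ (x' : X.H a) (y : Y.H b), ⟪f x', y⟫_ℂ =
      ⟪x', φ (lp.single ∞ b (InnerProductSpace.rankOne ℂ y z)) a x⟫_ℂ := by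
  let w : Y.H b →ₗ[ℂ] X.H a :=
    { toFun := fun y => φ (lp.single ∞ b (InnerProductSpace.rankOne ℂ y z)) a x
      map_add' := fun y y' => by
        simp only [map_add, add_apply, lp.single_add, lp.coeFn_add, Pi.add_apply]
      map_smul' := fun r y => by
        simp only [map_smul, smul_apply, lp.single_smul, lp.coeFn_smul, Pi.smul_apply,
          RingHom.id_apply] }
  -- Multiplicativity of `φ` together with `c |y⟩⟨z| = |c y⟩⟨z|`.
  have hw : ∀ (c : LInf Y) (y : Y.H b), φ c a (w y) = w (c b y) := fun c y => by
    change (φ c * φ (lp.single ∞ b (InnerProductSpace.rankOne ℂ y z)) : LInf X) a x = _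
    rw [← map_mul, LInf.mul_single]
    have : c b * InnerProductSpace.rankOne ℂ y z = InnerProductSpace.rankOne ℂ (c b y) z := by
      ext y'
      simp [InnerProductSpace.rankOne_apply]
    rw [this]
    rfl
  refine ⟨LinearMap.adjoint w, fun c x' => ?_, fun x' y => LinearMap.adjoint_inner_left _ _ _⟩
  refine ext_inner_right ℂ fun y => ?_
  rw [LinearMap.adjoint_inner_left, ← star_star c, inner_apply_star, map_star, inner_apply_star,
    LinearMap.adjoint_inner_left, hw]

open scoped ComplexOrder in
/-- A projection whose kernel contains the unit vector `e` is below `1 - |e⟩⟨e|`. -/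
theorem inner_le_inner_one_sub_rankOne {E : Type*} [NormedAddCommGroup E]
    [InnerProductSpace ℂ E] {q : E →L[ℂ] E} (hqq : ∀ x, q (q x) = q x)
    (hqs : ∀ x x', ⟪q x, x'⟫_ℂ = ⟪x, q x'⟫_ℂ) {e : E} (he : ‖e‖ = 1) (hqe : q e = 0) (x : E) :
    ⟪q x, x⟫_ℂ ≤ ⟪(1 - InnerProductSpace.rankOne ℂ e e : E →L[ℂ] E) x, x⟫_ℂ := by
  have h1 : ⟪e, q x⟫_ℂ = 0 := by rw [← hqs, hqe, inner_zero_left]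
  have h2 : ((‖x - q x‖ ^ 2 : ℝ) : ℂ) = ⟪x, x⟫_ℂ - ⟪q x, x⟫_ℂ := by
    have h : ((‖x - q x‖ ^ 2 : ℝ) : ℂ) = ⟪x - q x, x - q x⟫_ℂ := by
      rw [inner_self_eq_norm_sq_to_K]
      simp
    rw [h, inner_sub_left, inner_sub_right, inner_sub_right, hqs x (q x), hqq, ← hqs x x,
      sub_self, sub_zero]
  have h3 : ((‖⟪e, x⟫_ℂ‖ ^ 2 : ℝ) : ℂ) = conj ⟪e, x⟫_ℂ * ⟪e, x⟫_ℂ := by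
    rw [Complex.conj_mul', Complex.ofReal_pow]
  have h4 : ⟪(1 - InnerProductSpace.rankOne ℂ e e : E →L[ℂ] E) x, x⟫_ℂ - ⟪q x, x⟫_ℂ =
      ((‖x - q x‖ ^ 2 - ‖⟪e, x - q x⟫_ℂ‖ ^ 2 : ℝ) : ℂ) := by
    rw [Complex.ofReal_sub, h2, inner_sub_right e, h1, sub_zero, h3, sub_apply, one_apply_eq_self,
      InnerProductSpace.rankOne_apply, inner_sub_left, inner_smul_left]
    ring
  rw [← sub_nonneg, h4, Complex.zero_le_real, sub_nonneg]
  have h5 := norm_inner_le_norm (𝕜 := ℂ) e (x - q x)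
  rw [he, one_mul] at h5
  gcongr

-- If all intertwiners kill `h`, then so do all `φ(|z⟩⟨y|)`, hence `φ` of every finite atomic
-- projection. For `h ≠ 0` normalized to `e`, the element `1 - |e⟩⟨e|` would then be an upper bound
-- of these images below their supremum `1`.
open scoped ComplexOrder in
theorem isTotal_intertwiners (hφ : IsNormalHom φ) : (intertwiners φ).IsTotal := by
  classical
  intro a h hh
  have h1 : ∀ (b : Y.At) (y z : Y.H b),
      φ (lp.single ∞ b (InnerProductSpace.rankOne ℂ z y)) a h = 0 := by
    intro b y z
    -- Moving `φ(|z⟩⟨y|)` to the other side turns it into `φ(|y⟩⟨z|)`, the operator from which the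
    -- intertwiners were made.
    refine ext_inner_right ℂ fun x => ?_
    obtain ⟨f, hf, hf'⟩ := exists_intertwiner (φ := φ) a b x z
    have h2 := hf' h y
    rw [hh b f hf, inner_zero_left] at h2
    have h3 : (lp.single ∞ b (InnerProductSpace.rankOne ℂ z y) : LInf Y) =
        star (lp.single ∞ b (InnerProductSpace.rankOne ℂ y z)) := by
      rw [LInf.star_single, ContinuousLinearMap.star_eq_adjoint,
        InnerProductSpace.adjoint_rankOne]
    rw [h3, map_star, inner_apply_star, ← h2, inner_zero_left]
  have h2 : ∀ b : Y.At, φ (lp.single ∞ b 1) a h = 0 := by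
    intro b
    have h3 : (lp.single ∞ b 1 : LInf Y) = ∑ k, lp.single ∞ b (InnerProductSpace.rankOne ℂ
        (stdOrthonormalBasis ℂ (Y.H b) k) (stdOrthonormalBasis ℂ (Y.H b) k)) := by
      have h4 := map_sum (lp.singleAddMonoidHom (E := fun b : Y.At => Y.H b →L[ℂ] Y.H b) ∞ b)
        (fun k => InnerProductSpace.rankOne ℂ (stdOrthonormalBasis ℂ (Y.H b) k)
          (stdOrthonormalBasis ℂ (Y.H b) k)) Finset.univ
      rw [OrthonormalBasis.sum_rankOne_eq_id] at h4
      exact h4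
    rw [h3, map_sum, lp.coeFn_sum, Finset.sum_apply, sum_apply]
    exact Finset.sum_eq_zero fun k _ => h1 b _ _
  have h3 : ∀ s, φ (atomProj s) a h = 0 := by
    intro s
    rw [atomProj, map_sum, lp.coeFn_sum, Finset.sum_apply, sum_apply]
    exact Finset.sum_eq_zero fun b _ => by convert h2 b
  by_contra h0
  have hlub := hφ (Set.range atomProj) 1 ⟨_, ∅, rfl⟩ (by
    rintro _ ⟨s, rfl⟩ _ ⟨t, rfl⟩
    exact ⟨_, ⟨s ∪ t, rfl⟩, atomProj_mono Finset.subset_union_left,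
      atomProj_mono Finset.subset_union_right⟩) (by
    rintro _ ⟨s, rfl⟩
    exact star_atomProj s) isLUB_atomProj
  rw [map_one] at hlub
  let e : X.H a := ((‖h‖⁻¹ : ℝ) : ℂ) • h
  have he : ‖e‖ = 1 := by
    rw [norm_smul, Complex.norm_real, norm_inv, norm_norm,
      inv_mul_cancel₀ (norm_ne_zero_iff.2 h0)]
  have hle : 1 ≤ (1 - lp.single ∞ a (InnerProductSpace.rankOne ℂ e e) : LInf X) := hlub.2 (by
    rintro _ ⟨_, ⟨s, rfl⟩, rfl⟩
    refine LInf.le_iff.2 fun a' x => ?_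
    have h4 := LInf.le_iff.1 (hlub.1 ⟨_, ⟨s, rfl⟩, rfl⟩) a' x
    rw [lp.coeFn_sub, Pi.sub_apply]
    by_cases ha : a' = a
    · subst ha
      rw [lp.single_apply_self, lp.infty_coeFn_one]
      refine inner_le_inner_one_sub_rankOne (fun x => ?_) (fun x x' => ?_) he ?_ x
      · have h5 := congrArg φ (atomProj_mul_self s)
        rw [map_mul] at h5
        exact congrArg (fun c : LInf X => c a' x) h5
      · rw [← inner_apply_star, ← map_star, star_atomProj]
      · rw [map_smul, h3, smul_zero]
    · rw [lp.single_apply_ne _ _ _ ha, sub_zero]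
      exact h4)
  -- Testing at `e` itself yields the contradiction `1 ≤ 0`.
  have h4 := LInf.le_iff.1 hle a e
  rw [lp.coeFn_sub, Pi.sub_apply, lp.single_apply_self, sub_apply, inner_sub_left,
    InnerProductSpace.rankOne_apply, inner_smul_left, inner_self_eq_norm_sq_to_K, he] at h4
  have h5 := (Complex.le_def.1 h4).1
  norm_num at h5

end Intertwiners

theorem mainTheorem3 (X Y : QSet.{u, v}) :
    Set.BijOn BinRel.bend {F : BinRel X Y | F.IsFunction}
      {G : QRel ![X, Y.dual] | IsFunctionGraph G} ∧
    ∃ Φ : {G : QRel ![X, Y.dual] // IsFunctionGraph G} ≃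
        {φ : LInf Y →⋆ₐ[ℂ] LInf X // IsNormalHom φ},
      ∀ (F : BinRel X Y), F.IsFunction →
        ∀ G : {G : QRel ![X, Y.dual] // IsFunctionGraph G}, G.1 = F.bend →
          ∀ φ : {φ : LInf Y →⋆ₐ[ℂ] LInf X // IsNormalHom φ},
            (Φ G = φ ↔ IsDualHom F φ.1) ∧ (Φ G = φ ↔ F = intertwiners φ.1) := by
  refine ⟨⟨fun F hF => BinRel.isFunctionGraph_bend.2 hF, BinRel.bend_injective.injOn,
    fun G hG => ?_⟩, ?_⟩
  · obtain ⟨F, rfl⟩ := BinRel.exists_bend_eq G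
    exact ⟨F, BinRel.isFunctionGraph_bend.1 hG, rfl⟩
  have hfun : ∀ φ : LInf Y →⋆ₐ[ℂ] LInf X, IsNormalHom φ → (intertwiners φ).IsFunction :=
    fun φ hφ => BinRel.isFunction_iff.2 ⟨isTotal_intertwiners hφ, isUnivalent_intertwiners⟩
  have hdual : ∀ φ : LInf Y →⋆ₐ[ℂ] LInf X, IsDualHom (intertwiners φ) φ :=
    fun φ a b f hf => hf
  -- The bijection is built backwards: the graph of a homomorphism has an explicit formula, while
  -- the homomorphism of a graph is known only to exist.
  let Ψ : {φ : LInf Y →⋆ₐ[ℂ] LInf X // IsNormalHom φ} →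
      {G : QRel ![X, Y.dual] // IsFunctionGraph G} :=
    fun φ => ⟨(intertwiners φ.1).bend, BinRel.isFunctionGraph_bend.2 (hfun φ.1 φ.2)⟩
  have hΨ : Function.Bijective Ψ := by
    constructor
    · rintro ⟨φ, hφ⟩ ⟨ψ, hψ⟩ h
      have h1 : intertwiners φ = intertwiners ψ := BinRel.bend_injective (congrArg Subtype.val h)
      refine Subtype.ext (IsDualHom.eq (isTotal_intertwiners hφ) (hdual φ) ?_)
      rw [h1]
      exact hdual ψ
    · rintro ⟨G, hG⟩
      obtain ⟨F, rfl⟩ := BinRel.exists_bend_eq G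
      obtain ⟨hT, hU⟩ := BinRel.isFunction_iff.1 (BinRel.isFunctionGraph_bend.1 hG)
      obtain ⟨φ, hφ⟩ := exists_isDualHom hT hU
      exact ⟨⟨φ, hφ.isNormalHom hT hU⟩, Subtype.ext (by
        change (intertwiners φ).bend = F.bend
        rw [← hφ.eq_intertwiners hT hU])⟩
  refine ⟨(Equiv.ofBijective Ψ hΨ).symm, fun F hF G hG φ => ?_⟩
  obtain ⟨hT, hU⟩ := BinRel.isFunction_iff.1 hF
  have h1 : (Equiv.ofBijective Ψ hΨ).symm G = φ ↔ F = intertwiners φ.1 := by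
    rw [Equiv.symm_apply_eq, Subtype.ext_iff, hG]
    exact BinRel.bend_injective.eq_iff
  refine ⟨h1.trans ⟨fun h => ?_, fun h => h.eq_intertwiners hT hU⟩, h1⟩
  rw [h]
  exact hdual φ.1
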